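/- Let $k$ be a perfect field of characteristic $p>0$ and let $X$ be a smooth $k$-scheme of pure dimension $n$ (for example a smooth connected variety with $n=\dim X$), equipped with a symplectic form $\omega\in H^0(X,\Omega^2_X)$ (closed and non-degenerate) and with the induced Poisson bracket $\{-,-\}$ on $\mathcal O_X$. Let $\mathcal O_h$ be a quantization of $X$: a sheaf of associative $k[[h]]$-algebras on $X$ with an isomorphism $\mathcal O_h/h\mathcal O_h\cong\mathcal O_X$, such that for each affine open $U\subset X$ the $k[[h]]$-algebra $\mathcal O_h(U)$ is flat, is complete and separated in the $h$-adic topology, satisfies $\mathcal O_h(U)/h\mathcal O_h(U)\cong\mathcal O_X(U)$, and has commutator equal to $h\{-,-\}$ modulo $h^2$. Assume that $\mathcal O_h$ is Frobenius-constant, that is, the embedding $\mathcal O_X^p=\{f^p\}\hookrightarrow\mathcal O_X$ lifts to a morphism $s$ of sheaves of $k$-algebras from $\mathcal O_X^p$ to the center of $\mathcal O_h$, and fix any such $s$. Let $X^{(1)}=(X,\mathcal O_X^p)$ be the Frobenius twist, and let $\widehat X^{(1)}$ be the completion of $X^{(1)}\times\operatorname{Spec}k[h]$ along $X^{(1)}\times\{0\}$,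 whose functions over an affine open $U$ are $\mathcal O_X^p(U)[[h]]$. The $h$-adically continuous extension $\sum a_ih^i\mapsto\sum s(a_i)h^i$ of $s$ makes $\mathcal O_h$ a sheaf of algebras on $\widehat X^{(1)}$. Then the restriction $\mathcal O_h[h^{-1}]$ of $\mathcal O_h$ to the generic fiber of $\widehat X^{(1)}$ is an Azumaya algebra of rank $p^{n}=p^{\dim X}$. Explicitly: for each affine open $U\subset X$, the algebra $\mathcal O_h(U)[h^{-1}]$ is an Azumaya algebra over $\mathcal O_X^p(U)[[h]][h^{-1}]$, and is a projective module of constant rank $p^{n}$ over it; and for affine opens $V\subset U$ the restriction map induces an isomorphism $$\mathcal O_X^p(V)[[h]][h^{-1}]\otimes_{\mathcal O_X^p(U)[[h]][h^{-1}]}\mathcal O_h(U)[h^{-1}]\;\cong\;\mathcal O_h(V)[h^{-1}].$$ -/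

import Mathlib

open CategoryTheory AlgebraicGeometry TensorProduct Opposite

universe u

/-! ### Algebra over a field: symplectic forms, Poisson bracket, quantizations -/

section Affine

variable (k : Type*) [Field k] (A : Type*) [CommRing A] [Algebra k A]

/-- A bilinear form on the vector fields of the affine `k`-scheme `Spec A`. -/
abbrev BilinearFormOnVectorFields : Type _ :=
  Derivation k A A →ₗ[A] Derivation k A A →ₗ[A] A

variable {k A}

/-- `ω` is a symplectic form on the smooth affine scheme `Spec A`: an alternating form on vector
fields (that is, a 2-form, as the cotangent module is finite projective), closed for the exterior
derivative (given by Cartan's formula), and non-degenerate. -/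
structure IsSymplecticForm (ω : BilinearFormOnVectorFields k A) : Prop where
  alternating : ∀ D, ω D D = 0
  closed : ∀ D₁ D₂ D₃ : Derivation k A A,
    D₁ (ω D₂ D₃) - D₂ (ω D₁ D₃) + D₃ (ω D₁ D₂)
      - ω ⁅D₁, D₂⁆ D₃ + ω ⁅D₁, D₃⁆ D₂ - ω ⁅D₂, D₃⁆ D₁ = 0
  nondegenerate : Function.Bijective ω

/-- The differential `df` of a function, as the linear form `D ↦ D f` on vector fields. -/
def differentialForm (f : A) : Derivation k A A →ₗ[A] A where
  toFun D := D f
  map_add' _ _ := rfl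
  map_smul' _ _ := rfl

/-- The Hamiltonian vector field of `f`: the unique `D` with `ω(D, E) = E f` for all `E`. -/
noncomputable def hamiltonianVectorField {ω : BilinearFormOnVectorFields k A}
    (hω : IsSymplecticForm ω) (f : A) : Derivation k A A :=
  (LinearEquiv.ofBijective ω hω.nondegenerate).symm (differentialForm f)

/-- The Poisson bracket of a symplectic form: the derivative of `g` along the Hamiltonian vector
field of `f`. -/
noncomputable def poissonBracket {ω : BilinearFormOnVectorFields k A}
    (hω : IsSymplecticForm ω) (f g : A) : A :=
  hamiltonianVectorField hω f g

/-- The quantization parameter `h` in a `k⟦h⟧`-algebra. -/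
noncomputable def hbar (k : Type*) [Field k] (B : Type*) [Ring B] [Algebra (PowerSeries k) B] :
    B :=
  algebraMap (PowerSeries k) B PowerSeries.X

/-- `B`, with the reduction map `π : B → A`, is a quantization of the commutative `k`-algebra `A`
with bracket `br`: it is an associative flat `k⟦h⟧`-algebra, complete and separated in the `h`-adic
topology, `π` is a map of algebras over `k⟦h⟧ → k` that induces an isomorphism `B / h B ≅ A`, and
the commutator of `B` is `h · br` modulo `h²`. -/
structure IsQuantization (br : A → A → A) (B : Type*) [Ring B] [Algebra (PowerSeries k) B]
    (π : B →+* A) : Prop where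
  flat : Module.Flat (PowerSeries k) B
  complete : IsAdicComplete (Ideal.span {(PowerSeries.X : PowerSeries k)}) B
  map_algebraMap : ∀ c : PowerSeries k,
    π (algebraMap (PowerSeries k) B c) = algebraMap k A (PowerSeries.constantCoeff c)
  surjective : Function.Surjective π
  ker : ∀ b, π b = 0 → ∃ c, b = hbar k B * c
  commutator : ∀ a b, ∃ c, a * b - b * a = hbar k B * c ∧ π c = br (π a) (π b)

end Affine

section PthPowers

variable (k : Type*) [Field k] (p : ℕ) [Fact p.Prime] [CharP k p] [PerfectRing k p]
variable (A : Type*) [CommRing A] [Algebra k A]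

theorem natCast_prime_eq_zero (k : Type*) [Field k] (p : ℕ) [CharP k p] (A : Type*) [CommRing A]
    [Algebra k A] : (p : A) = 0 := by
  rw [← map_natCast (algebraMap k A), CharP.cast_eq_zero, map_zero]

/-- The algebra `A^p` of `p`-th powers of elements of `A`. -/
def pthPowers : Subalgebra k A where
  carrier := {a | ∃ f : A, f ^ p = a}
  mul_mem' := by
    rintro _ _ ⟨f, rfl⟩ ⟨g, rfl⟩
    exact ⟨f * g, mul_pow _ _ _⟩
  add_mem' := by
    rintro _ _ ⟨f, rfl⟩ ⟨g, rfl⟩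
    obtain ⟨r, hr⟩ := exists_add_pow_prime_eq (Fact.out : p.Prime) f g
    exact ⟨f + g, by rw [hr, natCast_prime_eq_zero k p A]; simp⟩
  algebraMap_mem' := by
    intro c
    obtain ⟨d, hd⟩ := surjective_frobenius k p c
    exact ⟨algebraMap k A d, by rw [← map_pow, ← hd, frobenius_def]⟩

/-- A ring homomorphism maps `p`-th powers to `p`-th powers. -/
def pthPowersMap {A B : Type*} [CommRing A] [Algebra k A] [CommRing B] [Algebra k B]
    (φ : A →+* B) : pthPowers k p A →+* pthPowers k p B where
  toFun a := ⟨φ a, by obtain ⟨f, hf⟩ := a.2; exact ⟨φ f, by rw [← map_pow, hf]⟩⟩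
  map_one' := by ext; simp
  map_mul' _ _ := by ext; simp
  map_zero' := by ext; simp
  map_add' _ _ := by ext; simp

end PthPowers

/-! ### The `h`-linear and `h`-continuous extension of a central homomorphism `R → B` to `R⟦h⟧` -/

section Extension

variable {k : Type*} [Field k] {B : Type*} [Ring B] [Algebra (PowerSeries k) B]
variable {R : Type*} [CommRing R] (s : R →+* Subring.center B)

theorem hbar_comm (b : B) : hbar k B * b = b * hbar k B := Algebra.commutes _ _

theorem hbar_pow_comm (n : ℕ) (b : B) : hbar k B ^ n * b = b * hbar k B ^ n :=
  ((Commute.pow_left (hbar_comm b)) n)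

theorem smodEq_iff_hbar (x y : B) (n : ℕ) :
    x ≡ y [SMOD (Ideal.span {(PowerSeries.X : PowerSeries k)} ^ n • ⊤ :
      Submodule (PowerSeries k) B)] ↔ ∃ c, x - y = hbar k B ^ n * c := by
  rw [SModEq.sub_mem, Ideal.span_singleton_pow, Submodule.ideal_span_singleton_smul,
    Submodule.mem_smul_pointwise_iff_exists]
  constructor
  · rintro ⟨c, -, hc⟩
    exact ⟨c, by rw [← hc, Algebra.smul_def, map_pow]; rfl⟩
  · rintro ⟨c, hc⟩
    exact ⟨c, trivial, by rw [hc, Algebra.smul_def, map_pow]; rfl⟩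

/-- The homomorphism `R[h] → B` that extends `s` and maps `h` to `h`. -/
noncomputable def polynomialExtension (k : Type*) [Field k] {B : Type*} [Ring B]
    [Algebra (PowerSeries k) B] {R : Type*} [CommRing R] (s : R →+* Subring.center B) :
    Polynomial R →+* B :=
  (Subring.center B).subtype.comp
    (Polynomial.eval₂RingHom s ⟨hbar k B, Subring.mem_center_iff.2 fun b ↦ (hbar_comm b).symm⟩)

theorem polynomialExtension_comm (f : Polynomial R) (b : B) :
    polynomialExtension k s f * b = b * polynomialExtension k s f :=
  ((Subring.mem_center_iff.1 (Polynomial.eval₂RingHom s ⟨hbar k B, _⟩ f).2) b).symm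

theorem polynomialExtension_X : polynomialExtension k s Polynomial.X = hbar k B := by
  simp [polynomialExtension]

theorem polynomialExtension_of_coeff {f g : Polynomial R} {n : ℕ}
    (hfg : ∀ i < n, f.coeff i = g.coeff i) :
    ∃ c, polynomialExtension k s f - polynomialExtension k s g = hbar k B ^ n * c := by
  obtain ⟨q, hq⟩ : Polynomial.X ^ n ∣ f - g :=
    Polynomial.X_pow_dvd_iff.2 fun i hi ↦ by simp [hfg i hi]
  exact ⟨polynomialExtension k s q, by
    rw [← map_sub, hq, map_mul, map_pow, polynomialExtension_X]⟩

theorem eq_of_hbar (hB : IsAdicComplete (Ideal.span {(PowerSeries.X : PowerSeries k)}) B)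
    {x y : B} (h : ∀ n : ℕ, ∃ c, x - y = hbar k B ^ n * c) : x = y := by
  rw [← sub_eq_zero]
  refine hB.toIsHausdorff.haus' _ fun n ↦ (smodEq_iff_hbar _ _ n).2 ?_
  simpa using h n

theorem exists_extension (hB : IsAdicComplete (Ideal.span {(PowerSeries.X : PowerSeries k)}) B)
    (f : PowerSeries R) : ∃ L : B, ∀ n, ∃ c,
      L - polynomialExtension k s (PowerSeries.trunc n f) = hbar k B ^ n * c := by
  obtain ⟨L, hL⟩ := hB.toIsPrecomplete.prec'
    (fun n ↦ polynomialExtension k s (PowerSeries.trunc n f)) (by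
      intro m n hmn
      refine (smodEq_iff_hbar _ _ m).2 (polynomialExtension_of_coeff s fun i hi ↦ ?_)
      simp [PowerSeries.coeff_trunc, hi, hi.trans_le hmn])
  exact ⟨L, fun n ↦ (smodEq_iff_hbar _ _ n).1 (hL n).symm⟩

theorem extension_unique (hB : IsAdicComplete (Ideal.span {(PowerSeries.X : PowerSeries k)}) B)
    (f : PowerSeries R) {x y : B}
    (hx : ∀ n, ∃ c, x - polynomialExtension k s (PowerSeries.trunc n f) = hbar k B ^ n * c)
    (hy : ∀ n, ∃ c, y - polynomialExtension k s (PowerSeries.trunc n f) = hbar k B ^ n * c) :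
    x = y := by
  refine eq_of_hbar hB fun n ↦ ?_
  obtain ⟨c, hc⟩ := hx n
  obtain ⟨d, hd⟩ := hy n
  exact ⟨c - d, by rw [mul_sub, ← hc, ← hd]; abel⟩

/-- The homomorphism `R⟦h⟧ → B`, `∑ aᵢ hⁱ ↦ ∑ s(aᵢ) hⁱ`, where the sum on the right is the limit
of its partial sums in the `h`-adic topology. -/
noncomputable def powerSeriesExtension
    (hB : IsAdicComplete (Ideal.span {(PowerSeries.X : PowerSeries k)}) B)
    (s : R →+* Subring.center B) : PowerSeries R →+* B where
  toFun f := (exists_extension s hB f).choose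
  map_one' := by
    refine extension_unique s hB 1 (exists_extension s hB 1).choose_spec fun n ↦ ?_
    rw [← map_one (polynomialExtension k s)]
    refine polynomialExtension_of_coeff s fun i hi ↦ ?_
    simp [PowerSeries.coeff_trunc, hi, PowerSeries.coeff_one, Polynomial.coeff_one]
  map_zero' := by
    refine extension_unique s hB 0 (exists_extension s hB 0).choose_spec fun n ↦ ⟨0, by simp⟩
  map_add' f g := by
    refine extension_unique s hB _ (exists_extension s hB _).choose_spec fun n ↦ ?_
    obtain ⟨c, hc⟩ := (exists_extension s hB f).choose_spec n
    obtain ⟨d, hd⟩ := (exists_extension s hB g).choose_spec n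
    exact ⟨c + d, by rw [mul_add, ← hc, ← hd, map_add, map_add]; abel⟩
  map_mul' f g := by
    refine extension_unique s hB _ (exists_extension s hB _).choose_spec fun n ↦ ?_
    obtain ⟨c, hc⟩ := (exists_extension s hB f).choose_spec n
    obtain ⟨d, hd⟩ := (exists_extension s hB g).choose_spec n
    obtain ⟨e, he⟩ := polynomialExtension_of_coeff (k := k) s
      (f := PowerSeries.trunc n f * PowerSeries.trunc n g)
      (g := PowerSeries.trunc n (f * g)) (n := n) (by
        intro i hi
        rw [PowerSeries.coeff_trunc, if_pos hi, Polynomial.coeff_mul, PowerSeries.coeff_mul]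
        refine Finset.sum_congr rfl fun x hx ↦ ?_
        have hx' : x.1 + x.2 = i := by simpa using hx
        rw [PowerSeries.coeff_trunc, PowerSeries.coeff_trunc, if_pos (by omega),
          if_pos (by omega)])
    set F := (exists_extension s hB f).choose
    set G := (exists_extension s hB g).choose
    rw [map_mul] at he
    refine ⟨c * G + polynomialExtension k s (PowerSeries.trunc n f) * d + e, ?_⟩
    rw [mul_add, mul_add, ← mul_assoc, ← mul_assoc, ← hc, hbar_pow_comm, mul_assoc, ← hd, ← he]
    noncomm_ring

theorem powerSeriesExtension_comm
    (hB : IsAdicComplete (Ideal.span {(PowerSeries.X : PowerSeries k)}) B)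
    (s : R →+* Subring.center B) (f : PowerSeries R) (b : B) :
    powerSeriesExtension hB s f * b = b * powerSeriesExtension hB s f := by
  refine eq_of_hbar hB fun n ↦ ?_
  obtain ⟨c, hc⟩ := (exists_extension s hB f).choose_spec n
  have hF : powerSeriesExtension hB s f =
      polynomialExtension k s (PowerSeries.trunc n f) + hbar k B ^ n * c := by
    rw [← hc]
    exact (add_sub_cancel _ _).symm
  refine ⟨c * b - b * c, ?_⟩
  rw [hF, add_mul, mul_add, polynomialExtension_comm, mul_sub, ← mul_assoc, ← mul_assoc,
    ← mul_assoc, hbar_pow_comm n b]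
  abel

/-- The algebra structure over `R⟦h⟧` on `B` that is given by `powerSeriesExtension`. -/
noncomputable abbrev powerSeriesAlgebra
    (hB : IsAdicComplete (Ideal.span {(PowerSeries.X : PowerSeries k)}) B)
    (s : R →+* Subring.center B) : Algebra (PowerSeries R) B :=
  RingHom.toAlgebra' (powerSeriesExtension hB s) (powerSeriesExtension_comm hB s)

end Extension

/-! ### Symplectic schemes and their quantizations -/

section Schemes

variable {k : Type u} [Field k] {X : Scheme.{u}} [X.Over (Spec (.of k))]

/-- The functions on an open subset of a `k`-scheme form a `k`-algebra. -/
noncomputable instance sectionsAlgebra (U : X.Opens) : Algebra k Γ(X, U) :=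
  ((Scheme.ΓSpecIso (.of k)).inv ≫
    (X ↘ Spec (.of k)).appLE ⊤ U le_top).hom.toAlgebra

/-- Restriction of functions from `U` to `V ⊆ U`. -/
noncomputable def restrictFunctions {U V : X.Opens} (i : V ≤ U) : Γ(X, U) →+* Γ(X, V) :=
  (X.presheaf.map (homOfLE i).op).hom

variable (k X) in
/-- A symplectic form on a smooth `k`-scheme `X`: a compatible family of symplectic forms on the
affine open subschemes of `X`. -/
structure SymplecticForm where
  form (U : X.affineOpens) : BilinearFormOnVectorFields k Γ(X, U)
  isSymplecticForm (U : X.affineOpens) : IsSymplecticForm (form U)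
  restrict {U V : X.affineOpens} (i : V.1 ≤ U.1) (D E : Derivation k Γ(X, U) Γ(X, U))
    (D' E' : Derivation k Γ(X, V) Γ(X, V))
    (hD : ∀ f, D' (restrictFunctions i f) = restrictFunctions i (D f))
    (hE : ∀ f, E' (restrictFunctions i f) = restrictFunctions i (E f)) :
    form V D' E' = restrictFunctions i (form U D E)

/-- A quantization of the symplectic scheme `(X, ω)`: a sheaf of `k⟦h⟧`-algebras on `X`, with a
morphism to the structure sheaf, that is over every affine open a quantization of the algebra of
functions with its Poisson bracket. -/
structure SchemeQuantization (ω : SymplecticForm k X) where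
  sheaf : TopCat.Sheaf (AlgCat.{u} (PowerSeries k)) X
  reduction (U : X.Opens) : sheaf.presheaf.obj (op U) →+* Γ(X, U)
  reduction_restrict {U V : X.Opens} (i : V ≤ U) (b : sheaf.presheaf.obj (op U)) :
    reduction V ((sheaf.presheaf.map (homOfLE i).op).hom b) =
      restrictFunctions i (reduction U b)
  isQuantization (U : X.affineOpens) :
    IsQuantization (k := k) (poissonBracket (ω.isSymplecticForm U))
      (sheaf.presheaf.obj (op U.1)) (reduction U)

/-- Restriction from `U` to `V ⊆ U` of sections of a quantization. -/
noncomputable def SchemeQuantization.restrict {ω : SymplecticForm k X} (Q : SchemeQuantization ω)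
    {U V : X.Opens} (i : V ≤ U) :
    Q.sheaf.presheaf.obj (op U) →+* Q.sheaf.presheaf.obj (op V) :=
  (Q.sheaf.presheaf.map (homOfLE i).op).hom.toRingHom

variable (p : ℕ) [Fact p.Prime] [CharP k p] [PerfectRing k p] {ω : SymplecticForm k X}

/-- A Frobenius-constant structure on a quantization `Q`: a morphism of sheaves of `k`-algebras from
the sheaf of `p`-th powers of functions to the center of `Q` that lifts the inclusion of `p`-th
powers into all functions. -/
structure FrobeniusLift (Q : SchemeQuantization ω) where
  lift (U : X.Opens) : pthPowers k p Γ(X, U) →+* Subring.center (Q.sheaf.presheaf.obj (op U))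
  lift_algebraMap (U : X.Opens) (c : k) :
    (lift U (algebraMap k (pthPowers k p Γ(X, U)) c) : Q.sheaf.presheaf.obj (op U)) =
      algebraMap (PowerSeries k) (Q.sheaf.presheaf.obj (op U)) (PowerSeries.C c)
  lift_restrict {U V : X.Opens} (i : V ≤ U) (a : pthPowers k p Γ(X, U)) :
    (lift V (pthPowersMap k p (restrictFunctions i) a) : Q.sheaf.presheaf.obj (op V)) =
      Q.restrict i (lift U a)
  reduction_lift (U : X.Opens) (a : pthPowers k p Γ(X, U)) :
    Q.reduction U (lift U a : Q.sheaf.presheaf.obj (op U)) = a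

variable (k)

/-- The functions on the affine open of the formal completion of `X⁽¹⁾ × 𝔸¹` along
`X⁽¹⁾ × {0}` that corresponds to `U`, where `X⁽¹⁾` is the Frobenius twist `(X, 𝒪_X^p)`. -/
abbrev formalFunctions (U : X.affineOpens) : Type u :=
  PowerSeries (pthPowers k p Γ(X, U))

/-- The functions on the generic fiber of that affine open of the formal completion. -/
abbrev genericFunctions (U : X.affineOpens) : Type u :=
  Localization.Away (PowerSeries.X : formalFunctions k p U)

/-- Restriction from `U` to `V ⊆ U` of functions on the formal completion. -/
noncomputable def restrictFormalFunctions {U V : X.affineOpens} (i : V.1 ≤ U.1) :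
    formalFunctions k p U →+* formalFunctions k p V :=
  PowerSeries.map (pthPowersMap k p (restrictFunctions i))

/-- The ring `genericFunctions k p V` as an algebra over `formalFunctions k p U`, for `V ⊆ U`. -/
noncomputable abbrev genericFunctionsAlgebra {U V : X.affineOpens} (i : V.1 ≤ U.1) :
    Algebra (formalFunctions k p U) (genericFunctions k p V) :=
  ((algebraMap (formalFunctions k p V) (genericFunctions k p V)).comp
    (restrictFormalFunctions k p i)).toAlgebra

variable {k p}

namespace FrobeniusLift

variable {Q : SchemeQuantization ω} (s : FrobeniusLift p Q)

/-- The sections of the quantization `Q` over an affine open `U`, seen as sections of a sheaf of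
algebras on the formal completion of `X⁽¹⁾ × 𝔸¹`: the functions on that completion act through the
lift `s` of the `p`-th powers and the parameter `h`. -/
def sections (_ : FrobeniusLift p Q) (U : X.affineOpens) : Type u :=
  Q.sheaf.presheaf.obj (op U.1)

noncomputable instance (U : X.affineOpens) : Ring (s.sections U) :=
  inferInstanceAs (Ring (Q.sheaf.presheaf.obj (op U.1)))

noncomputable instance (U : X.affineOpens) : Algebra (formalFunctions k p U) (s.sections U) :=
  powerSeriesAlgebra (B := Q.sheaf.presheaf.obj (op U.1)) (Q.isQuantization U).complete (s.lift U)

/-- Restriction from `U` to `V ⊆ U` of sections of the quantization. -/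
noncomputable def restrictSections {U V : X.affineOpens} (i : V.1 ≤ U.1) :
    s.sections U →+* s.sections V :=
  Q.restrict i

/-- The sections over `U` of the restriction `Q[h⁻¹]` of `Q` to the generic fiber. -/
abbrev genericSections (U : X.affineOpens) : Type u :=
  genericFunctions k p U ⊗[formalFunctions k p U] s.sections U

/-- The restriction `Q[h⁻¹]` of `Q` to the generic fiber of the formal completion of `X⁽¹⁾ × 𝔸¹`
along `X⁽¹⁾ × {0}` is an Azumaya algebra of rank `r`: over every affine open it is an Azumaya
algebra over the functions on the generic fiber, a projective module of constant rank `r`, and for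
affine opens `V ⊆ U` its sections over `V` are obtained from those over `U` by base change. -/
structure IsAzumayaOnGenericFiber (r : ℕ) : Prop where
  isAzumaya (U : X.affineOpens) : IsAzumaya (genericFunctions k p U) (s.genericSections U)
  rank (U : X.affineOpens) (x : PrimeSpectrum (genericFunctions k p U)) :
    Module.rankAtStalk (s.genericSections U) x = r
  baseChange {U V : X.affineOpens} (i : V.1 ≤ U.1) :
    letI := genericFunctionsAlgebra k p i
    ∃ e : (genericFunctions k p V ⊗[formalFunctions k p U] s.sections U) ≃ₗ[genericFunctions k p V]
        s.genericSections V,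
      ∀ (g : genericFunctions k p V) (b : s.sections U),
        e (g ⊗ₜ[formalFunctions k p U] b) =
          g ⊗ₜ[formalFunctions k p V] s.restrictSections i b

end FrobeniusLift

end Schemes

/-! Over an affine open, let `A` be the ring of functions, `R = A^p`, and `B` the sections of the
quantization, an algebra over `R⟦h⟧`. Locally on `Spec R` there are coordinates whose monomials of
degree `< p` in each variable form a basis of `A` over `R`, so `A` is projective of rank `p^n` over
`R`. Since `B` is `h`-torsion-free and separated with `B/hB = A`, it is isomorphic to `R⟦h⟧ ⊗ A` as
a module (`exists_powerSeries_tensor_equiv`), hence projective of rank `p^n` over `R⟦h⟧`.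

For the Azumaya property, consider the endomorphisms of `B` that enter the image of `B ⊗ Bᵒᵖ` after
multiplication by a power of `h`. They form a subalgebra that contains the left multiplications and
the operators `h⁻¹[a, -]`. Modulo `h` these become the multiplications on `A` and the Hamiltonian
vector fields. By non-degeneracy of the form, Hamiltonian vector fields generate all derivations
locally; derivations and multiplications in turn generate `End_R(A)`, because products of the
`∂ᵢ^(p-1)` extract coefficients of monomials (`subalgebra_eq_top_of_hamiltonian`). As `h` lies in
the Jacobson radical of `R⟦h⟧`, Nakayama's lemma shows that the subalgebra is all of `End(B)`
(`IsFormalQuantization.pow_smul_mem_range_mulLeftRight`). Once `h` is inverted, `B ⊗ Bᵒᵖ → End(B)`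
is therefore a surjection of projective modules of equal rank, hence bijective.

Base change from `U` to `V` follows the same pattern: the functions on `U` span those on `V` over
the `p`-th powers (`span_range_restrictFunctions`), Nakayama lifts this to a surjection over power
series, and equality of ranks makes it bijective. -/

/-! ### Local dual bases -/

section LocalDualBasis

variable {R M ι : Type*} [CommRing R] [AddCommGroup M] [Module R M] [Fintype ι] [DecidableEq ι]

/-- Families `b` in `M` and `φ` in the dual of `M` that become dual bases once `w` is inverted. -/
structure IsLocalDualBasis (w : R) (b : ι → M) (φ : ι → M →ₗ[R] R) : Prop where
  apply_eq : ∀ i j, φ i (b j) = if i = j then w else 0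
  sum_smul : ∀ a, ∑ i, φ i a • b i = w • a

theorem IsLocalDualBasis.finrank_eq [Nontrivial R] {w : R} {b : ι → M} {φ : ι → M →ₗ[R] R}
    (h : IsLocalDualBasis w b φ) (hw : IsUnit w) : Module.finrank R M = Fintype.card ι := by
  have hb : Function.Bijective (LinearMap.pi φ) := by
    constructor
    · rw [injective_iff_map_eq_zero]
      intro a ha
      have h0 := h.sum_smul a
      simp only [LinearMap.pi_apply, funext_iff, Pi.zero_apply] at ha
      simp only [ha, zero_smul, Finset.sum_const_zero] at h0
      exact (hw.smul_eq_zero).1 h0.symm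
    · intro c
      obtain ⟨v, rfl⟩ := hw
      refine ⟨∑ j, (c j * (↑v⁻¹ : R)) • b j, ?_⟩
      ext i
      simp [h.apply_eq]
  rw [(LinearEquiv.ofBijective _ hb).finrank_eq, Module.finrank_fintype_fun_eq_card]

theorem IsLocalDualBasis.baseChange {w : R} {b : ι → M} {φ : ι → M →ₗ[R] R}
    (h : IsLocalDualBasis w b φ) (S : Type*) [CommRing S] [Algebra R S] :
    IsLocalDualBasis (algebraMap R S w) (fun i ↦ (1 : S) ⊗ₜ[R] b i)
      (fun i ↦ (AlgebraTensorModule.rid R S S).toLinearMap ∘ₗ (φ i).baseChange S) where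
  apply_eq i j := by
    simp only [LinearMap.comp_apply, LinearMap.baseChange_tmul, h.apply_eq]
    split_ifs <;> simp [Algebra.smul_def]
  sum_smul a := by
    induction a with
    | zero => simp
    | add x y hx hy => simp only [map_add, add_smul, Finset.sum_add_distrib, hx, hy, smul_add]
    | tmul s a =>
      simp only [LinearMap.comp_apply, LinearMap.baseChange_tmul, LinearEquiv.coe_coe,
        AlgebraTensorModule.rid_tmul, TensorProduct.smul_tmul', smul_eq_mul, mul_one]
      simp_rw [TensorProduct.smul_tmul, ← TensorProduct.tmul_sum, h.sum_smul,
        ← TensorProduct.smul_tmul, Algebra.smul_def]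

/-- The scalars `r` for which `r • id` factors through a finite free module form an ideal: sums are
handled by direct sums of the free modules. Each local dual basis puts its `w` into this ideal, so
it contains `1`. -/
theorem projective_and_finite_of_span_localDualBasis
    (h : Ideal.span {w : R | ∃ (b : ι → M) (φ : ι → M →ₗ[R] R), IsLocalDualBasis w b φ} = ⊤) :
    Module.Projective R M ∧ Module.Finite R M := by
  suffices H : ∀ r ∈ Ideal.span {w : R | ∃ (b : ι → M) (φ : ι → M →ₗ[R] R),
      IsLocalDualBasis w b φ}, ∃ (m : ℕ) (f : M →ₗ[R] (Fin m → R)) (g : (Fin m → R) →ₗ[R] M),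
        g ∘ₗ f = r • LinearMap.id by
    obtain ⟨m, f, g, hfg⟩ := H 1 (by rw [h]; trivial)
    rw [one_smul] at hfg
    exact ⟨Module.Projective.of_split f g hfg,
      Module.Finite.of_surjective g fun x ↦ ⟨f x, LinearMap.congr_fun hfg x⟩⟩
  intro r hr
  induction hr using Submodule.span_induction with
  | mem w hw =>
    obtain ⟨b, φ, hw⟩ := hw
    let e := (Fintype.equivFin ι).symm
    refine ⟨Fintype.card ι, LinearMap.pi fun i ↦ φ (e i), Fintype.linearCombination R (b ∘ e), ?_⟩
    ext a
    simp only [LinearMap.comp_apply, Fintype.linearCombination_apply, LinearMap.pi_apply,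
      Function.comp_apply, LinearMap.smul_apply, LinearMap.id_apply, ← hw.sum_smul]
    exact Equiv.sum_comp e fun i ↦ φ i a • b i
  | zero => exact ⟨0, 0, 0, by simp⟩
  | add r s _ _ hr hs =>
    obtain ⟨m, f, g, h1⟩ := hr
    obtain ⟨m', f', g', h2⟩ := hs
    let e := (LinearEquiv.sumArrowLequivProdArrow (Fin m) (Fin m') R R).symm ≪≫ₗ
      LinearEquiv.funCongrLeft R R finSumFinEquiv.symm
    refine ⟨m + m', e.toLinearMap ∘ₗ f.prod f', g.coprod g' ∘ₗ e.symm.toLinearMap, ?_⟩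
    ext a
    have h1 := LinearMap.congr_fun h1 a
    have h2 := LinearMap.congr_fun h2 a
    simp only [LinearMap.comp_apply, LinearMap.smul_apply, LinearMap.id_apply] at h1 h2
    simp [h1, h2, add_smul]
  | smul c r _ hr =>
    obtain ⟨m, f, g, h1⟩ := hr
    exact ⟨m, f, c • g, by rw [LinearMap.smul_comp, h1, smul_smul, smul_eq_mul]⟩

/-- Every prime misses some `w`, and over the local ring at that prime the dual bases become genuine
ones. -/
theorem rankAtStalk_of_span_localDualBasis
    (h : Ideal.span {w : R | ∃ (b : ι → M) (φ : ι → M →ₗ[R] R), IsLocalDualBasis w b φ} = ⊤)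
    (q : PrimeSpectrum R) : Module.rankAtStalk M q = Fintype.card ι := by
  obtain ⟨w, ⟨b, φ, hw⟩, hwq⟩ : ∃ w ∈ {w : R | ∃ (b : ι → M) (φ : ι → M →ₗ[R] R),
      IsLocalDualBasis w b φ}, w ∉ q.asIdeal := by
    by_contra! H
    exact q.isPrime.ne_top (top_le_iff.1 (h ▸ Ideal.span_le.2 H))
  rw [Module.rankAtStalk_eq_finrank_tensorProduct]
  exact (hw.baseChange (Localization.AtPrime q.asIdeal)).finrank_eq
    (IsLocalization.map_units (M := q.asIdeal.primeCompl) _ ⟨w, hwq⟩)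

end LocalDualBasis

/-! ### Coordinates in characteristic `p` -/

section Coordinates

variable {R A : Type*} [CommRing R] [CommRing A] [Algebra R A]

theorem Derivation.pow_apply_mul_pow (D : Derivation R A A) {g : R} {x c : A}
    (hx : D x = algebraMap R A g) (hc : D c = 0) (a m : ℕ) :
    ((D : A →ₗ[R] A) ^ m) (c * x ^ a) =
      (a.descFactorial m : A) * (algebraMap R A g ^ m * (c * x ^ (a - m))) := by
  induction m with
  | zero => simp
  | succ m ih =>
    rw [pow_succ', Module.End.mul_apply, ih, Nat.descFactorial_succ]
    simp only [Derivation.coeFn_coe, Derivation.leibniz, Derivation.map_natCast,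
      Derivation.leibniz_pow, hc, hx, Derivation.map_algebraMap, smul_eq_mul, Nat.sub_sub,
      smul_zero, mul_zero, add_zero, nsmul_eq_mul, Nat.cast_mul]
    ring

/-- This is the coefficient in `∂^(p-1) x^a`. It is `(p-1)! = -1` by Wilson for `a = p - 1`, it
vanishes for smaller `a`, and for `p ≤ a ≤ 2p - 2` the product passes through the factor `p`. -/
theorem descFactorial_cast_eq (p : ℕ) [hp : Fact p.Prime] (hA : (p : A) = 0) {a : ℕ}
    (ha : a < p + (p - 1)) :
    (a.descFactorial (p - 1) : A) = if a = p - 1 then -1 else 0 := by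
  have h0 := hp.out.pos
  split_ifs with h
  · subst h
    rw [Nat.descFactorial_self]
    have h1 : ((((p - 1).factorial + 1 : ℕ) : ZMod p)) = 0 := by
      push_cast
      rw [ZMod.wilsons_lemma]
      ring
    obtain ⟨c, hc⟩ := (ZMod.natCast_eq_zero_iff _ _).1 h1
    have h2 := congrArg (Nat.cast : ℕ → A) hc
    push_cast at h2
    rw [hA, zero_mul] at h2
    exact eq_neg_of_add_eq_zero_left h2
  · rcases lt_or_ge a (p - 1) with h1 | h1
    · rw [Nat.descFactorial_eq_zero_iff_lt.2 h1, Nat.cast_zero]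
    · have h2 : p ∣ a.descFactorial (p - 1) := by
        rw [Nat.descFactorial_eq_prod_range]
        have : p = a - (a - p) := by omega
        conv_lhs => rw [this]
        exact Finset.dvd_prod_of_mem _ (Finset.mem_range.2 (by omega))
      obtain ⟨c, hc⟩ := h2
      rw [hc, Nat.cast_mul, hA, zero_mul]

variable {n : ℕ}

/-- The constant `c` is what makes the induction run: the operators of the tail kill `x i`, so `x i
^ a i` can be absorbed into `c` before they act. -/
theorem prod_pow_derivation_apply (p : ℕ) [hp : Fact p.Prime] (hA : (p : A) = 0) {g : R}
    {x : Fin n → A} {D : Fin n → Derivation R A A}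
    (hD : ∀ i j, D i (x j) = if i = j then algebraMap R A g else 0)
    (a : Fin n → ℕ) (ha : ∀ i, a i < p + (p - 1)) (l : List (Fin n)) (hl : l.Nodup) (c : A)
    (hc : ∀ i ∈ l, D i c = 0) :
    (l.map fun i ↦ (D i : A →ₗ[R] A) ^ (p - 1)).prod (c * (l.map fun i ↦ x i ^ a i).prod) =
      c * (l.map fun i ↦ if a i = p - 1 then -algebraMap R A g ^ (p - 1) else 0).prod := by
  induction l generalizing c with
  | nil => simp
  | cons i l ih =>
    rw [List.nodup_cons] at hl
    simp only [List.map_cons, List.prod_cons, Module.End.mul_apply]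
    rw [← mul_assoc, ih hl.2 (c * x i ^ a i)]
    · set e := (l.map fun i ↦ if a i = p - 1 then -algebraMap R A g ^ (p - 1) else 0).prod with he
      have he' : D i (c * e) = 0 := by
        obtain ⟨r, hr⟩ : ∃ r, e = algebraMap R A r := by
          refine ⟨(l.map fun i ↦ if a i = p - 1 then -g ^ (p - 1) else 0).prod, ?_⟩
          rw [he, map_list_prod, List.map_map]
          congr 2
          ext i
          simp [apply_ite (algebraMap R A)]
        rw [hr, Derivation.leibniz, Derivation.map_algebraMap, hc i (by simp)]
        simp
      rw [mul_right_comm, Derivation.pow_apply_mul_pow (D i) (by rw [hD, if_pos rfl]) he',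
        descFactorial_cast_eq p hA (ha i)]
      split_ifs with h
      · rw [h]; simp; ring
      · simp
    · intro j hj
      have hji : j ≠ i := fun h ↦ hl.1 (h ▸ hj)
      rw [Derivation.leibniz, Derivation.leibniz_pow, hD, if_neg hji, hc j (by simp [hj])]
      simp

/-- The monomials of degree `< p` in each variable. -/
def monomials (p : ℕ) (x : Fin n → A) (α : Fin n → Fin p) : A := ∏ i, x i ^ (α i : ℕ)

/-- The differential operator that extracts a multiple of the coefficient of the monomial with
exponents `β`. -/
noncomputable def coefficientOperator (p : ℕ) (x : Fin n → A) (D : Fin n → Derivation R A A)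
    (β : Fin n → Fin p) : A →ₗ[R] A :=
  ((List.finRange n).map fun i ↦ (D i : A →ₗ[R] A) ^ (p - 1)).prod *
    LinearMap.mulLeft R (∏ i, x i ^ (p - 1 - (β i : ℕ)))

/-- Multiplication by the complementary monomial turns the exponents into `p - 1 - βᵢ + γᵢ`, which
stay below `2p - 1` and all equal `p - 1` exactly when `β = γ`. -/
theorem coefficientOperator_monomials (p : ℕ) [hp : Fact p.Prime] (hA : (p : A) = 0) {g : R}
    {x : Fin n → A} {D : Fin n → Derivation R A A}
    (hD : ∀ i j, D i (x j) = if i = j then algebraMap R A g else 0) (β γ : Fin n → Fin p) :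
    coefficientOperator p x D β (monomials p x γ) =
      if β = γ then algebraMap R A ((-g ^ (p - 1)) ^ n) else 0 := by
  have h := prod_pow_derivation_apply p hA hD (fun i ↦ (p - 1 - (β i : ℕ)) + γ i)
    (fun i ↦ by have := (β i).2; have := (γ i).2; omega) (List.finRange n)
    (List.nodup_finRange n) 1 (fun i _ ↦ by simp)
  rw [one_mul, one_mul, ← Fin.prod_univ_def, ← Fin.prod_univ_def] at h
  rw [coefficientOperator, Module.End.mul_apply, LinearMap.mulLeft_apply, monomials,
    ← Finset.prod_mul_distrib]
  simp_rw [← pow_add]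
  rw [h]
  split_ifs with hβ
  · subst hβ
    rw [Finset.prod_congr rfl fun i _ ↦ if_pos (by have := (β i).2; omega)]
    simp
  · obtain ⟨i, hi⟩ := Function.ne_iff.1 hβ
    refine Finset.prod_eq_zero (Finset.mem_univ i) (if_neg ?_)
    have := (β i).2; have := (γ i).2
    rw [← Fin.val_ne_iff] at hi
    omega

/-- `x` and `D` are coordinates and dual derivations, and the monomials of degree `< p` in each
coordinate span, after the element `g` has been inverted. -/
structure IsCoordinateSystem (p : ℕ) (g : R) (x : Fin n → A) (D : Fin n → Derivation R A A) :
    Prop where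
  apply_eq : ∀ i j, D i (x j) = if i = j then algebraMap R A g else 0
  span : ∃ N : ℕ, ∀ a, g ^ N • a ∈ Submodule.span R (Set.range (monomials p x))

variable {p : ℕ} {g : R} {x : Fin n → A} {D : Fin n → Derivation R A A}

theorem IsCoordinateSystem.exists_localDualBasis [Fact p.Prime]
    (h : IsCoordinateSystem p g x D)
    (hA : (p : A) = 0) (hR : Function.Injective (algebraMap R A)) :
    ∃ (N : ℕ) (φ : (Fin n → Fin p) → A →ₗ[R] R),
      IsLocalDualBasis (g ^ N * (-g ^ (p - 1)) ^ n) (monomials p x) φ := by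
  obtain ⟨N, hN⟩ := h.span
  have hφ := coefficientOperator_monomials p hA h.apply_eq
  set u := (-g ^ (p - 1)) ^ n
  have hc : ∀ (c : (Fin n → Fin p) → R) (β),
      coefficientOperator p x D β (∑ γ, c γ • monomials p x γ) = algebraMap R A (c β * u) := by
    intro c β
    rw [map_sum]
    simp only [map_smul, hφ]
    simp [Algebra.smul_def]
  choose c hc' using fun a ↦ (Submodule.mem_span_range_iff_exists_fun R).1 (hN a)
  -- A coefficient operator takes values in `A`, but on `g ^ N • a`, a combination of monomials, its
  -- value is a scalar from `R`.
  have hmem : ∀ β a, (g ^ N • coefficientOperator p x D β) a ∈ (Algebra.linearMap R A).range := by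
    intro β a
    rw [LinearMap.smul_apply, ← map_smul, ← hc' a, hc]
    exact ⟨_, rfl⟩
  let e := LinearEquiv.ofInjective (Algebra.linearMap R A) hR
  have he : ∀ y, algebraMap R A (e.symm y) = y := fun y ↦
    congrArg Subtype.val (e.apply_symm_apply y)
  refine ⟨N + N, fun β ↦ g ^ N • (e.symm.toLinearMap ∘ₗ LinearMap.codRestrict _ _ (hmem β)), ?_⟩
  have key : ∀ β a, e.symm (LinearMap.codRestrict _ _ (hmem β) a) = c a β * u := by
    intro β a
    apply hR
    rw [he, LinearMap.codRestrict_apply, LinearMap.smul_apply, ← map_smul, ← hc' a, hc]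
  constructor
  · intro β γ
    apply hR
    rw [LinearMap.smul_apply, smul_eq_mul, map_mul, LinearMap.comp_apply, LinearEquiv.coe_coe, he,
      LinearMap.codRestrict_apply, LinearMap.smul_apply, hφ]
    split_ifs
    · rw [Algebra.smul_def, ← map_mul, ← map_mul]; congr 1; ring
    · simp
  · intro a
    simp only [LinearMap.smul_apply, LinearMap.comp_apply, LinearEquiv.coe_coe, key]
    rw [show g ^ (N + N) * u = (g ^ N * u) * g ^ N by ring, mul_smul, ← hc' a, Finset.smul_sum]
    refine Finset.sum_congr rfl fun γ _ ↦ ?_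
    rw [smul_smul, smul_eq_mul]
    congr 1
    ring

/-- The operators that lie in `S` after multiplication by a power of `g`. -/
def Subalgebra.powSaturation {E : Type*} [Ring E] [Algebra R E] (S : Subalgebra R E) (g : R) :
    Subalgebra R E where
  carrier := {e | ∃ N : ℕ, g ^ N • e ∈ S}
  mul_mem' := by
    rintro a b ⟨M, hM⟩ ⟨N, hN⟩
    exact ⟨M + N, by rw [pow_add, ← smul_mul_smul_comm]; exact S.mul_mem hM hN⟩
  add_mem' := by
    rintro a b ⟨M, hM⟩ ⟨N, hN⟩
    refine ⟨M + N, ?_⟩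
    rw [smul_add]
    refine S.add_mem ?_ ?_
    · rw [add_comm, pow_add, mul_smul]; exact S.smul_mem hM _
    · rw [pow_add, mul_smul]; exact S.smul_mem hN _
  algebraMap_mem' r := ⟨0, by simp⟩

theorem Subalgebra.le_powSaturation {E : Type*} [Ring E] [Algebra R E] (S : Subalgebra R E)
    (g : R) : S ≤ S.powSaturation g := fun e he ↦ ⟨0, by simpa using he⟩

/-- Up to a power of `g` and a sign, `E` equals the sum over `β` of the coefficient operator at `β`
followed by multiplication by the value of `E` on the monomial `β`. -/
theorem IsCoordinateSystem.exists_pow_smul_mem [Fact p.Prime] (h : IsCoordinateSystem p g x D)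
    (hA : (p : A) = 0) (S : Subalgebra R (Module.End R A))
    (hmul : ∀ a, LinearMap.mulLeft R a ∈ S)
    (hD : ∀ i, ∃ N : ℕ, g ^ N • (D i : A →ₗ[R] A) ∈ S) (E : Module.End R A) :
    ∃ N : ℕ, g ^ N • E ∈ S := by
  obtain ⟨N, hN⟩ := h.span
  have hφ := coefficientOperator_monomials p hA h.apply_eq
  have hmem : ∀ β, coefficientOperator p x D β ∈ S.powSaturation g := by
    intro β
    refine mul_mem (list_prod_mem ?_) (S.le_powSaturation g (hmul _))
    simp only [List.mem_map, forall_exists_index, and_imp]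
    rintro _ i - rfl
    exact pow_mem (hD i : _ ∈ S.powSaturation g) _
  let ψ : Module.End R A :=
    ∑ β, LinearMap.mulLeft R (E (monomials p x β)) * coefficientOperator p x D β
  have hψ : ψ ∈ S.powSaturation g :=
    sum_mem fun β _ ↦ mul_mem (S.le_powSaturation g (hmul _)) (hmem β)
  have hψE : g ^ N • ψ = (g ^ N * (-g ^ (p - 1)) ^ n) • E := by
    ext a
    have : ∀ y ∈ Submodule.span R (Set.range (monomials p x)),
        ψ y = (-g ^ (p - 1)) ^ n • E y := by
      intro y hy
      induction hy using Submodule.span_induction with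
      | mem y hy =>
        obtain ⟨γ, rfl⟩ := hy
        simp only [ψ, LinearMap.sum_apply, Module.End.mul_apply, hφ, LinearMap.mulLeft_apply,
          mul_ite, mul_zero, Finset.sum_ite_eq', Finset.mem_univ, if_true, Algebra.smul_def]
        rw [mul_comm]
      | zero => simp
      | add y z _ _ hy hz => rw [map_add, map_add, hy, hz, smul_add]
      | smul c y _ hy => rw [map_smul, map_smul, hy, smul_comm]
    rw [LinearMap.smul_apply, ← map_smul, this _ (hN a), map_smul, smul_smul, mul_comm,
      LinearMap.smul_apply]
  obtain ⟨M, hM⟩ := hψ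
  refine ⟨M + (N + (p - 1) * n), ?_⟩
  -- The factor `(-1) ^ n` cancels the sign in `(-g ^ (p - 1)) ^ n`.
  have h1 : g ^ (M + (N + (p - 1) * n)) • E = (-1 : R) ^ n • (g ^ N • (g ^ M • ψ)) := by
    rw [smul_comm (g ^ N), hψE, smul_smul, smul_smul]
    congr 1
    have h2 : ((-1 : R) ^ n) * (-1) ^ n = 1 := by rw [← mul_pow]; simp
    rw [neg_pow (g ^ (p - 1)), ← pow_mul, pow_add, pow_add]
    linear_combination (-(g ^ M * (g ^ N * g ^ ((p - 1) * n)))) * h2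
  rw [h1]
  exact S.smul_mem (S.smul_mem hM _) _

theorem Derivation.sum_apply {ι : Type*} (s : Finset ι) (f : ι → Derivation R A A) (a : A) :
    (∑ i ∈ s, f i) a = ∑ i ∈ s, f i a := by
  classical
  induction s using Finset.induction_on with
  | empty => simp
  | insert i s hi ih => rw [Finset.sum_insert hi, Finset.sum_insert hi, Derivation.add_apply, ih]

/-- The derivation `g • E - ∑ E(xᵢ) Dᵢ` kills the coordinates, hence the `R`-span of their
monomials, and this span contains `g ^ N • A`. -/
theorem IsCoordinateSystem.exists_smul_derivation_eq (h : IsCoordinateSystem p g x D) :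
    ∃ N : ℕ, ∀ E : Derivation R A A, g ^ (N + 1) • E = g ^ N • ∑ i, E (x i) • D i := by
  obtain ⟨N, hN⟩ := h.span
  refine ⟨N, fun E ↦ ?_⟩
  let F := g • E - ∑ i, E (x i) • D i
  have hx : ∀ j, F (x j) = 0 := by
    intro j
    simp only [F, Derivation.sub_apply, Derivation.smul_apply]
    rw [Derivation.sum_apply]
    simp [h.apply_eq, Algebra.smul_def, mul_comm]
  have hF : ∀ y ∈ Submodule.span R (Set.range (monomials p x)), F y = 0 := by
    intro y hy
    induction hy using Submodule.span_induction with
    | mem y hy =>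
      obtain ⟨γ, rfl⟩ := hy
      rw [monomials]
      refine Finset.prod_induction _ (fun y ↦ F y = 0) ?_ (by simp) ?_
      · intro a b ha hb
        simp [Derivation.leibniz, ha, hb]
      · intro i _
        simp [Derivation.leibniz_pow, hx]
    | zero => simp
    | add y z _ _ hy hz => rw [map_add, hy, hz, add_zero]
    | smul c y _ hy => rw [Derivation.map_smul, hy, smul_zero]
  rw [pow_succ, mul_smul, ← sub_eq_zero, ← smul_sub]
  ext a
  have := hF _ (hN a)
  rw [Derivation.map_smul] at this
  exact this

end Coordinates

/-! ### Finite projective modules and Azumaya algebras -/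

section Rank

variable {R : Type*} [CommRing R]

/-- The surjection splits, so its kernel is finite projective of rank zero at every prime, hence
zero. -/
theorem bijective_of_surjective_of_rankAtStalk_eq {M N : Type*} [AddCommGroup M] [Module R M]
    [AddCommGroup N] [Module R N] [Module.Finite R M] [Module.Projective R M]
    [Module.Projective R N] (f : M →ₗ[R] N) (hf : Function.Surjective f)
    (h : Module.rankAtStalk (R := R) M = Module.rankAtStalk N) : Function.Bijective f := by
  refine ⟨?_, hf⟩
  have : Module.Finite R N := Module.Finite.of_surjective f hf
  obtain ⟨g, hg⟩ := Module.projective_lifting_property f LinearMap.id hf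
  have hg' : ∀ x, f (g x) = x := LinearMap.congr_fun hg
  let q : M →ₗ[R] f.ker := LinearMap.codRestrict _ (LinearMap.id - g ∘ₗ f) fun x ↦ by simp [hg']
  have hq : ∀ x : f.ker, q x = x := by
    rintro ⟨x, hx⟩
    ext
    simp only [LinearMap.mem_ker] at hx
    simp [q, hx]
  have : Module.Projective R f.ker := Module.Projective.of_split f.ker.subtype q (by ext; simp [hq])
  have : Module.Finite R f.ker := Module.Finite.of_surjective q fun x ↦ ⟨x, hq x⟩
  let e : M ≃ₗ[R] f.ker × N := LinearEquiv.ofLinearMap (q.prod f) (f.ker.subtype.coprod g)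
    (by
      ext x
      · simp [hq]
      · simp [hq]
      · simp [q, hg']
      · simp [hg'])
    (by ext; simp [q])
  have h1 := Module.rankAtStalk_eq_of_equiv e
  rw [Module.rankAtStalk_prod, h, eq_comm, add_eq_right] at h1
  have := Module.rankAtStalk_eq_zero_iff_subsingleton.1 h1
  exact LinearMap.ker_eq_bot.1 (Submodule.subsingleton_iff_eq_bot.1 this)

variable (R) in
theorem projective_and_finite_end (M : Type*) [AddCommGroup M] [Module R M] [Module.Finite R M]
    [Module.Projective R M] :
    Module.Projective R (Module.End R M) ∧ Module.Finite R (Module.End R M) := by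
  obtain ⟨m, f, g, -, -, hfg⟩ := Module.Finite.exists_comp_eq_id_of_projective R M
  have hfg' : ∀ x, f (g x) = x := LinearMap.congr_fun hfg
  let u : Module.End R M →ₗ[R] Module.End R (Fin m → R) :=
    LinearMap.llcomp R _ _ _ g ∘ₗ LinearMap.lcomp R M f
  let v : Module.End R (Fin m → R) →ₗ[R] Module.End R M :=
    LinearMap.llcomp R _ _ _ f ∘ₗ LinearMap.lcomp R (Fin m → R) g
  have huv : v ∘ₗ u = LinearMap.id := by
    ext φ x
    simp [u, v, hfg']
  exact ⟨Module.Projective.of_split u v huv,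
    Module.Finite.of_surjective v fun φ ↦ ⟨u φ, LinearMap.congr_fun huv φ⟩⟩

/-- For a finitely presented module `End` commutes with localization, and over a local ring the
module is free. -/
theorem rankAtStalk_end {M : Type*} [AddCommGroup M] [Module R M] [Module.Finite R M]
    [Module.Projective R M] (q : PrimeSpectrum R) :
    Module.rankAtStalk (Module.End R M) q = Module.rankAtStalk M q * Module.rankAtStalk M q := by
  have : Module.FinitePresentation R M := Module.finitePresentation_of_projective R M
  let S := q.asIdeal.primeCompl
  let g := LocalizedModule.mkLinearMap S M
  let e := (IsLocalizedModule.linearEquiv S (LocalizedModule.mkLinearMap S (M →ₗ[R] M))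
    (IsLocalizedModule.mapExtendScalars S g g
      (Localization S))).extendScalarsOfIsLocalization S (Localization S)
  have : Module.Free (Localization S) (LocalizedModule S M) :=
    Module.free_of_flat_of_isLocalRing (R := Localization.AtPrime q.asIdeal)
  have h := e.finrank_eq
  rw [Module.finrank_linearMap] at h
  exact h

end Rank

/-! ### The Azumaya property after inverting one element -/

section Azumaya

variable {R B : Type*} [CommRing R] [Ring B] [Algebra R B] [Module.Finite R B]
  [Module.Projective R B]

/-- By finite presentation, an endomorphism of `S ⊗ B` times a power of `t` comes from an
endomorphism of `B`; a further power of `t` brings the latter into the image of `B ⊗ Bᵒᵖ`. Both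
powers are units in `S`. -/
theorem exists_mulLeftRight_eq_of_isUnit {S : Type*} [CommRing S] [Algebra R S] (t : R)
    [IsLocalization.Away t S]
    (H : ∀ φ : Module.End R B, ∃ N : ℕ, t ^ N • φ ∈ (AlgHom.mulLeftRight R B).range) :
    Function.Surjective (AlgHom.mulLeftRight S (S ⊗[R] B)) := by
  intro ψ
  have : Module.FinitePresentation R B := Module.finitePresentation_of_projective R B
  let j : B →ₗ[R] S ⊗[R] B := TensorProduct.mk R S B 1
  have hj : IsLocalizedModule (Submonoid.powers t) j :=
    (isLocalizedModule_iff_isBaseChange _ S _).2 (TensorProduct.isBaseChange R B S)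
  obtain ⟨φ, ⟨_, N, rfl⟩, hφ⟩ := Module.FinitePresentation.exists_lift_of_isLocalizedModule
    (Submonoid.powers t) j (ψ.restrictScalars R ∘ₗ j)
  obtain ⟨M, z, hz⟩ := H φ
  obtain ⟨v, hv⟩ := (IsLocalization.Away.algebraMap_isUnit (S := S) t).pow (M + N)
  let J : B ⊗[R] Bᵐᵒᵖ →ₗ[R] (S ⊗[R] B) ⊗[S] (S ⊗[R] B)ᵐᵒᵖ :=
    TensorProduct.lift (LinearMap.mk₂ R (fun b c ↦ (1 ⊗ₜ b) ⊗ₜ[S] MulOpposite.op (1 ⊗ₜ c.unop))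
      (fun a b c ↦ by rw [tmul_add, add_tmul])
      (fun r b c ↦ by
        rw [TensorProduct.tmul_smul, ← algebraMap_smul S, ← TensorProduct.smul_tmul',
          algebraMap_smul])
      (fun a b c ↦ by rw [MulOpposite.unop_add, tmul_add, MulOpposite.op_add, tmul_add])
      (fun r b c ↦ by
        rw [MulOpposite.unop_smul, TensorProduct.tmul_smul, MulOpposite.op_smul,
          TensorProduct.tmul_smul]))
  have hJ : ∀ z b, AlgHom.mulLeftRight S (S ⊗[R] B) (J z) (1 ⊗ₜ b) =
      1 ⊗ₜ AlgHom.mulLeftRight R B z b := by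
    intro z b
    induction z with
    | zero => simp
    | add x y hx hy => simp only [map_add, LinearMap.add_apply, hx, hy, tmul_add]
    | tmul x y => simp [J]
  refine ⟨(↑v⁻¹ : S) • J z, ?_⟩
  rw [map_smul]
  apply TensorProduct.AlgebraTensorModule.curry_injective
  ext b
  simp only [AlgebraTensorModule.curry_apply, curry_apply,
    LinearMap.coe_restrictScalars, LinearMap.smul_apply]
  rw [hJ, ← Units.smul_def, inv_smul_eq_iff]
  have h1 : (1 : S) ⊗ₜ[R] φ b = algebraMap R S (t ^ N) • ψ (1 ⊗ₜ b) := by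
    rw [algebraMap_smul]
    exact LinearMap.congr_fun hφ b
  change AlgHom.mulLeftRight R B z = _ at hz
  rw [hz, LinearMap.smul_apply, TensorProduct.tmul_smul, h1, Units.smul_def, hv, ← map_pow,
    ← algebraMap_smul S, smul_smul, ← map_mul, pow_add]

/-- Surjectivity suffices, since source and target both have the square of the rank of `S ⊗ B` as
rank. -/
theorem isAzumaya_of_localization {S : Type*} [CommRing S] [Algebra R S] (t : R)
    [IsLocalization.Away t S] (hB : Function.Injective (algebraMap R B))
    (H : ∀ φ : Module.End R B, ∃ N : ℕ, t ^ N • φ ∈ (AlgHom.mulLeftRight R B).range) :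
    IsAzumaya S (S ⊗[R] B) := by
  have : Module.Flat R S := IsLocalization.flat S (Submonoid.powers t)
  have hinj : Function.Injective (algebraMap S (S ⊗[R] B)) :=
    Algebra.TensorProduct.includeLeft_injective (S := R) hB
  have : FaithfulSMul S (S ⊗[R] B) := (faithfulSMul_iff_algebraMap_injective _ _).2 hinj
  let e : (S ⊗[R] B) ≃ₗ[S] (S ⊗[R] B)ᵐᵒᵖ := MulOpposite.opLinearEquiv S
  have : Module.Projective S (S ⊗[R] B)ᵐᵒᵖ := Module.Projective.of_equiv e
  have : Module.Finite S (S ⊗[R] B)ᵐᵒᵖ := Module.Finite.equiv e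
  have : Module.FinitePresentation S (S ⊗[R] B) := Module.finitePresentation_of_projective _ _
  have := (projective_and_finite_end S (S ⊗[R] B)).1
  refine { bij := ?_ }
  refine bijective_of_surjective_of_rankAtStalk_eq (AlgHom.mulLeftRight S (S ⊗[R] B)).toLinearMap
    (exists_mulLeftRight_eq_of_isUnit t H) ?_
  ext q
  rw [rankAtStalk_end, Module.rankAtStalk_tensorProduct, ← Module.rankAtStalk_eq_of_equiv e]
  rfl

end Azumaya

/-! ### Modules over power series rings -/

section PowerSeriesModules

variable {R : Type*} [CommRing R]

theorem span_X_le_jacobson :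
    Ideal.span {(PowerSeries.X : PowerSeries R)} ≤ Ideal.jacobson ⊥ := by
  rw [Ideal.span_singleton_le_iff_mem, Ideal.mem_jacobson_bot]
  intro f
  rw [PowerSeries.isUnit_iff_constantCoeff]
  simp

theorem submodule_eq_top_of_powerSeries {M : Type*} [AddCommGroup M] [Module (PowerSeries R) M]
    [Module.Finite (PowerSeries R) M] (T : Submodule (PowerSeries R) M)
    (h : ∀ m, ∃ t ∈ T, ∃ c, m = t + (PowerSeries.X : PowerSeries R) • c) : T = ⊤ := by
  refine top_le_iff.1 (Submodule.le_of_le_smul_of_le_jacobson_bot (N' := ⊤)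
    (Module.finite_def.1 ‹_›) span_X_le_jacobson ?_)
  rintro m -
  obtain ⟨t, ht, c, rfl⟩ := h m
  exact Submodule.add_mem_sup ht
    (Submodule.smul_mem_smul (Ideal.mem_span_singleton_self _) trivial)

variable {A B : Type*} [AddCommGroup A] [Module R A] [AddCommGroup B] [Module R B]
  [Module (PowerSeries R) B] [IsScalarTower R (PowerSeries R) B]

theorem powerSeries_tensor_eq (x : PowerSeries R ⊗[R] A) :
    ∃ (a : A) (y : PowerSeries R ⊗[R] A), x = 1 ⊗ₜ a + (PowerSeries.X : PowerSeries R) • y := by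
  induction x with
  | zero => exact ⟨0, 0, by simp⟩
  | add x y hx hy =>
    obtain ⟨a, x', rfl⟩ := hx
    obtain ⟨b, y', rfl⟩ := hy
    exact ⟨a + b, x' + y', by rw [tmul_add, smul_add]; abel⟩
  | tmul f a =>
    refine ⟨PowerSeries.constantCoeff f • a,
      (PowerSeries.mk fun i ↦ PowerSeries.coeff (i + 1) f) ⊗ₜ a, ?_⟩
    conv_lhs => rw [PowerSeries.eq_X_mul_shift_add_const f]
    rw [add_tmul, add_comm, ← smul_tmul, ← smul_eq_mul, ← smul_tmul']
    congr 2
    rw [Algebra.smul_def, mul_one]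
    rfl

/-- A linear section of `π` extends to `R⟦X⟧ ⊗ A → B`. Separatedness of `B` is enough here: since
`A` is finite, the infinite sum of digits of an element of `B` is already given by finitely many
power series. -/
theorem exists_powerSeries_tensor_equiv [Module.Finite R A] [Module.Projective R A]
    (hH : ∀ b : B, (∀ n : ℕ, ∃ c, b = (PowerSeries.X : PowerSeries R) ^ n • c) → b = 0)
    (hT : ∀ b : B, (PowerSeries.X : PowerSeries R) • b = 0 → b = 0)
    (π : B →ₗ[R] A) (hπ : Function.Surjective π)
    (hX : ∀ b, π ((PowerSeries.X : PowerSeries R) • b) = 0)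
    (hker : ∀ b, π b = 0 → ∃ c, b = (PowerSeries.X : PowerSeries R) • c) :
    Nonempty ((PowerSeries R ⊗[R] A) ≃ₗ[PowerSeries R] B) := by
  obtain ⟨σ, hσ⟩ := Module.projective_lifting_property π LinearMap.id hπ
  have hσ' : ∀ a, π (σ a) = a := LinearMap.congr_fun hσ
  let τ : (PowerSeries R ⊗[R] A) →ₗ[PowerSeries R] B := σ.liftBaseChange (PowerSeries R)
  have hτ : ∀ f a, τ (f ⊗ₜ a) = f • σ a := fun f a ↦ by simp [τ]
  refine ⟨LinearEquiv.ofBijective τ ⟨?_, ?_⟩⟩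
  · rw [injective_iff_map_eq_zero]
    have step : ∀ n : ℕ, ∀ x, τ x = 0 → ∃ y, x = (PowerSeries.X : PowerSeries R) ^ n • y := by
      intro n
      induction n with
      | zero => exact fun x _ ↦ ⟨x, by simp⟩
      | succ n ih =>
        intro x hx
        obtain ⟨a, y, rfl⟩ := powerSeries_tensor_eq x
        have ha : a = 0 := by
          have := congrArg π hx
          rwa [map_add, map_add, hτ, one_smul, hσ', map_smul, hX, add_zero, map_zero] at this
        subst ha
        rw [tmul_zero, zero_add, map_smul] at hx
        obtain ⟨z, rfl⟩ := ih y (hT _ hx)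
        exact ⟨z, by rw [tmul_zero, zero_add, smul_smul, pow_succ']⟩
    -- As a retract of a free module, `A` gives an embedding of `R⟦X⟧ ⊗ A` into `R⟦X⟧ ^ m`, where
    -- only zero is divisible by all powers of `X`.
    obtain ⟨m, f, g, -, -, hfg⟩ := Module.Finite.exists_comp_eq_id_of_projective R A
    intro x hx
    have hinj : Function.Injective (g.baseChange (PowerSeries R)) := by
      refine Function.LeftInverse.injective (g := f.baseChange (PowerSeries R)) fun y ↦ ?_
      rw [← LinearMap.comp_apply, ← LinearMap.baseChange_comp, hfg, LinearMap.baseChange_id,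
        LinearMap.id_apply]
    apply hinj
    rw [map_zero]
    apply (TensorProduct.piScalarRight R (PowerSeries R) (PowerSeries R) (Fin m)).injective
    rw [map_zero]
    ext i j
    obtain ⟨y, hy⟩ := step (j + 1) x hx
    rw [hy, map_smul, map_smul, Pi.smul_apply, smul_eq_mul, PowerSeries.coeff_X_pow_mul',
      if_neg (by omega)]
    simp
  · obtain ⟨m, a, ha⟩ := Module.Finite.exists_fin (R := R) (M := A)
    have hs : ∀ y : A, ∃ c : Fin m → R, ∑ i, c i • a i = y := fun y ↦
      (Submodule.mem_span_range_iff_exists_fun R).1 (ha ▸ trivial)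
    choose c hc using hs
    have hn : ∀ b : B, ∃ b' : B, b = σ (π b) + (PowerSeries.X : PowerSeries R) • b' := by
      intro b
      obtain ⟨b', hb'⟩ := hker (b - σ (π b)) (by rw [map_sub, hσ', sub_self])
      exact ⟨b', by rw [← hb']; abel⟩
    choose next hnext using hn
    -- The `j`-th digit of `b` is `π (next^[j] b)`; the series `F b i` collects the coefficients of
    -- the generator `a i` in all digits.
    let F : B → Fin m → PowerSeries R := fun b i ↦ PowerSeries.mk fun j ↦ c (π (next^[j] b)) i
    let x : B → PowerSeries R ⊗[R] A := fun b ↦ ∑ i, F b i ⊗ₜ a i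
    have hF : ∀ b i, F b i = PowerSeries.C (c (π b) i) + PowerSeries.X * F (next b) i := by
      intro b i
      conv_lhs => rw [PowerSeries.eq_X_mul_shift_add_const (F b i)]
      rw [add_comm]
      congr 2
      ext j
      simp [F]
    have hx : ∀ b, x b = 1 ⊗ₜ π b + (PowerSeries.X : PowerSeries R) • x (next b) := by
      intro b
      simp only [x, hF b, add_tmul, Finset.sum_add_distrib, Finset.smul_sum]
      congr 1
      conv_rhs => rw [← hc (π b), tmul_sum]
      refine Finset.sum_congr rfl fun i _ ↦ ?_
      rw [← smul_tmul, Algebra.smul_def, mul_one]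
      rfl
    have hx' : ∀ b, b - τ (x b) = (PowerSeries.X : PowerSeries R) • (next b - τ (x (next b))) := by
      intro b
      conv_lhs => rw [hx b, map_add, hτ, one_smul, map_smul]
      nth_rw 1 [hnext b]
      rw [smul_sub]
      abel
    intro b
    refine ⟨x b, ?_⟩
    rw [eq_comm, ← sub_eq_zero]
    refine hH _ fun n ↦ ?_
    induction n generalizing b with
    | zero => exact ⟨b - τ (x b), by simp⟩
    | succ n ih =>
      obtain ⟨d, hd⟩ := ih (next b)
      exact ⟨d, by rw [hx', hd, smul_smul, pow_succ']⟩

end PowerSeriesModules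

/-! ### Coordinates on smooth algebras -/

section PurelyInseparable

/-- The kernel of `A ⊗ A → A` is nil, because `(1 ⊗ s - s ⊗ 1)^p = 1 ⊗ s^p - s^p ⊗ 1 = 0`.
Unramifiedness gives an element `t` that annihilates its generators and maps to `1`; then `1 - t` is
nilpotent, `t` is a unit, and the kernel vanishes. A finite epimorphism is surjective. -/
theorem surjective_algebraMap_of_pow_mem {R A : Type*} [CommRing R] [CommRing A] [Algebra R A]
    (p : ℕ) [hp : Fact p.Prime] (hA : (p : A) = 0) (h : ∀ a : A, ∃ r, algebraMap R A r = a ^ p)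
    [Module.Finite R A] [Algebra.FormallyUnramified R A] :
    Function.Surjective (algebraMap R A) := by
  rw [← Algebra.isEpi_iff_surjective_algebraMap_of_finite, Algebra.isEpi_iff_forall_one_tmul_eq]
  obtain ⟨t, ht, ht1⟩ := Algebra.FormallyUnramified.iff_exists_tensorProduct.1
    (inferInstance : Algebra.FormallyUnramified R A)
  have hp0 : (p : A ⊗[R] A) = 0 := by
    rw [← map_natCast (algebraMap A (A ⊗[R] A)), hA, map_zero]
  have hnil : KaehlerDifferential.ideal R A ≤ nilradical (A ⊗[R] A) := by
    rw [← KaehlerDifferential.span_range_eq_ideal, Ideal.span_le]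
    rintro _ ⟨s, rfl⟩
    refine mem_nilradical.2 ⟨p, ?_⟩
    set d : A ⊗[R] A := 1 ⊗ₜ s - s ⊗ₜ 1 with hd
    obtain ⟨r, hr⟩ := exists_add_pow_prime_eq hp.out d (s ⊗ₜ 1)
    obtain ⟨c, hc⟩ := h s
    rw [hp0, zero_mul, zero_mul, zero_mul, add_zero, hd, sub_add_cancel, ← hd] at hr
    rw [Algebra.TensorProduct.tmul_pow, Algebra.TensorProduct.tmul_pow, one_pow, ← hc,
      Algebra.algebraMap_eq_smul_one, tmul_smul, ← smul_tmul'] at hr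
    exact (right_eq_add.1 hr)
  have hu : IsUnit t := by
    have h1 : 1 - t ∈ KaehlerDifferential.ideal R A := by
      rw [KaehlerDifferential.ideal, RingHom.mem_ker, map_sub, map_one]
      exact sub_eq_zero.2 ht1.symm
    have := (mem_nilradical.1 (hnil h1)).isUnit_one_sub
    rwa [sub_sub_cancel] at this
  intro a
  have := ht a
  rwa [hu.mul_left_eq_zero, sub_eq_zero] at this

end PurelyInseparable

/-! ### Monomial bases over the `p`-th powers -/

section PthPowers

variable (k : Type*) [Field k] (p : ℕ) [hp : Fact p.Prime] [CharP k p] [PerfectRing k p]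
variable (A : Type*) [CommRing A] [Algebra k A]

variable {A} in
/-- The `p`-th power of `a`, as an element of the algebra of `p`-th powers. -/
def pthPower (a : A) : pthPowers k p A := ⟨a ^ p, a, rfl⟩

theorem finite_pthPowers [Algebra.FiniteType k A] : Module.Finite (pthPowers k p A) A := by
  have : Algebra.FiniteType (pthPowers k p A) A :=
    Algebra.FiniteType.of_restrictScalars_finiteType k _ _
  have : Algebra.IsIntegral (pthPowers k p A) A := ⟨fun a ↦ by
    refine IsIntegral.of_pow hp.out.pos ?_
    exact isIntegral_algebraMap (x := pthPower k p a)⟩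
  exact Algebra.IsIntegral.finite

variable {k p A}

/-- A derivation is linear over the `p`-th powers. -/
def Derivation.overPthPowers (D : Derivation k A A) : Derivation (pthPowers k p A) A A where
  toFun := D
  map_add' := map_add D
  map_smul' := by
    rintro ⟨_, f, rfl⟩ a
    simp [Algebra.smul_def, Derivation.leibniz, Derivation.leibniz_pow,
      natCast_prime_eq_zero k p A]
  map_one_eq_zero' := D.map_one_eq_zero
  leibniz' := D.leibniz

/-- Over the subalgebra `A'` generated by `x` and the `p`-th powers all differentials vanish, so `A`
is unramified over `A'` and equals it. -/
theorem span_monomials_eq_top [Algebra.FiniteType k A] {n : ℕ} (x : Fin n → A)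
    (hx : Submodule.span A (Set.range fun i ↦ KaehlerDifferential.D k A (x i)) = ⊤) :
    Submodule.span (pthPowers k p A) (Set.range (monomials p x)) = ⊤ := by
  have := finite_pthPowers k p A
  let A' := Algebra.adjoin (pthPowers k p A) (Set.range x)
  have : Module.Finite A' A := Module.Finite.of_restrictScalars_finite (pthPowers k p A) A' A
  have hun : Algebra.FormallyUnramified A' A := by
    rw [Algebra.formallyUnramified_iff]
    have : Function.Surjective (KaehlerDifferential.map k A' A A) :=
      KaehlerDifferential.map_surjective k A' A
    rw [← LinearMap.range_eq_top, LinearMap.range_eq_map, ← hx, Submodule.map_span,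
      ← Set.range_comp] at this
    refine subsingleton_of_forall_eq 0 fun y ↦ ?_
    have hy : y ∈ (⊤ : Submodule A (Ω[A⁄A'])) := trivial
    rw [← this] at hy
    refine (Submodule.span_le (p := ⊥)).2 ?_ hy
    rintro _ ⟨i, rfl⟩
    simp only [Function.comp_apply, KaehlerDifferential.map_D, Algebra.algebraMap_self,
      RingHom.id_apply]
    exact (KaehlerDifferential.D A' A).map_algebraMap
      (⟨x i, Algebra.subset_adjoin ⟨i, rfl⟩⟩ : A')
  have hsurj := surjective_algebraMap_of_pow_mem (R := A') p (natCast_prime_eq_zero k p A)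
    fun a ↦ ⟨algebraMap (pthPowers k p A) A' (pthPower k p a), rfl⟩
  rw [eq_top_iff]
  rintro a -
  obtain ⟨⟨a, ha⟩, rfl⟩ := hsurj a
  change a ∈ _
  rw [← Subalgebra.mem_toSubmodule, Algebra.adjoin_eq_span] at ha
  refine Submodule.span_le.2 ?_ ha
  intro y hy
  induction hy using Submonoid.closure_induction_left with
  | one => exact Submodule.subset_span ⟨fun _ ↦ ⟨0, hp.out.pos⟩, by simp [monomials]⟩
  | mul_left z hz y _ hy =>
    obtain ⟨i, rfl⟩ := hz
    have : Submodule.span (pthPowers k p A) (Set.range (monomials p x)) ≤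
        (Submodule.span (pthPowers k p A) (Set.range (monomials p x))).comap
          (LinearMap.mulLeft (pthPowers k p A) (x i)) := by
      rw [Submodule.span_le]
      rintro _ ⟨γ, rfl⟩
      simp only [SetLike.mem_coe, Submodule.mem_comap, LinearMap.mulLeft_apply]
      have hsplit : ∀ β : Fin n → Fin p, monomials p x β =
          x i ^ (β i : ℕ) * ∏ j ∈ Finset.univ.erase i, x j ^ (β j : ℕ) := fun β ↦
        (Finset.mul_prod_erase _ _ (Finset.mem_univ i)).symm
      have herase : ∀ c : Fin p, ∏ j ∈ Finset.univ.erase i, x j ^ (Function.update γ i c j : ℕ) =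
          ∏ j ∈ Finset.univ.erase i, x j ^ (γ j : ℕ) := fun c ↦
        Finset.prod_congr rfl fun j hj ↦ by
          rw [Function.update_of_ne (Finset.ne_of_mem_erase hj)]
      -- When the exponent reaches `p`, the factor `x i ^ p` becomes a scalar and the exponent
      -- restarts at `0`.
      by_cases h : (γ i : ℕ) + 1 < p
      · refine Submodule.subset_span ⟨Function.update γ i ⟨γ i + 1, h⟩, ?_⟩
        rw [hsplit, hsplit, herase, Function.update_self, ← mul_assoc, ← pow_succ']
      · have h' : x i * monomials p x γ = pthPower k p (x i) •
            monomials p x (Function.update γ i ⟨0, hp.out.pos⟩) := by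
          rw [hsplit, hsplit, herase, Function.update_self, ← mul_assoc, ← pow_succ',
            pow_zero, one_mul, show (γ i : ℕ) + 1 = p by have := (γ i).2; omega]
          rfl
        rw [h']
        exact Submodule.smul_mem _ _ (Submodule.subset_span ⟨_, rfl⟩)
    exact this hy

theorem exists_basis_kaehlerDifferential (n : ℕ)
    [H : Algebra.IsStandardSmoothOfRelativeDimension n k A] :
    ∃ (x : Fin n → A) (b : Module.Basis (Fin n) A (Ω[A⁄k])),
      ∀ i, b i = KaehlerDifferential.D k A (x i) := by
  obtain ⟨ι, σ, _, _, P, hP⟩ := H.out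
  have hcard : Nat.card ((Set.range P.map)ᶜ : Set ι) = n := by
    rw [Nat.card_coe_set_eq, Set.ncard_compl, ← hP, Algebra.Presentation.dimension,
      ← Nat.card_coe_set_eq, Nat.card_range_of_injective P.map_inj]
  let e : ((Set.range P.map)ᶜ : Set ι) ≃ Fin n := Finite.equivFinOfCardEq hcard
  exact ⟨fun i ↦ P.val (e.symm i), P.basisKaehler.reindex e, fun i ↦ by simp⟩

theorem eventually_pow_mul_eq {f : A} {S : Type*} [CommRing S] [Algebra A S]
    [IsLocalization.Away f S] {a b : A} (h : algebraMap A S a = algebraMap A S b) :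
    ∀ᶠ N : ℕ in Filter.atTop, f ^ N * a = f ^ N * b := by
  obtain ⟨M, hM⟩ := IsLocalization.Away.exists_of_eq f h
  filter_upwards [Filter.eventually_ge_atTop M] with N hN
  obtain ⟨c, rfl⟩ := Nat.exists_eq_add_of_le hN
  rw [pow_add, mul_comm (f ^ M), mul_assoc, mul_assoc, hM]

/-- Coordinates and dual derivations on the localization descend to `A` after denominators are
cleared by powers of `f`. Finite generation of `A` over the `p`-th powers and of `Ω[A⁄k]` over `A`
keeps the exponents bounded. -/
theorem exists_coordinates_of_away [Algebra.FiniteType k A] {n : ℕ} (f : A) {S : Type*}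
    [CommRing S] [Algebra A S] [Algebra k S] [IsScalarTower k A S] [IsLocalization.Away f S]
    [Algebra.FiniteType k S] (x : Fin n → S) (b : Module.Basis (Fin n) S (Ω[S⁄k]))
    (hb : ∀ i, b i = KaehlerDifferential.D k S (x i)) :
    ∃ (L : ℕ) (y : Fin n → A) (D : Fin n → Derivation (pthPowers k p A) A A),
      IsCoordinateSystem p (pthPower k p f ^ L) y D := by
  have hf : IsUnit (algebraMap A S f) := IsLocalization.Away.algebraMap_isUnit f
  have hDp : ∀ a : S, KaehlerDifferential.D k S (a ^ p) = 0 := by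
    intro a
    rw [Derivation.leibniz_pow, ← Nat.cast_smul_eq_nsmul S, natCast_prime_eq_zero k p S, zero_smul]
  -- coordinates that come from `A`
  have hy : ∀ i, ∃ (N : ℕ) (y : A), algebraMap A S y = (algebraMap A S f ^ N) ^ p * x i := by
    intro i
    obtain ⟨N, a, h⟩ := IsLocalization.Away.surj f (x i)
    -- The denominator `f ^ N` is enlarged to a `p`-th power, so that clearing it only rescales the
    -- differential of the coordinate by a unit.
    refine ⟨N, f ^ (N * (p - 1)) * a, ?_⟩
    rw [map_mul, ← h, map_pow, mul_left_comm, mul_comm, ← pow_mul]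
    congr 1
    rw [← pow_add]
    congr 1
    have := hp.out.pos
    obtain ⟨q, rfl⟩ : ∃ q, p = q + 1 := ⟨p - 1, by omega⟩
    simp
    ring
  choose N y hy using hy
  let b' := b.isUnitSMul (w := fun i ↦ (algebraMap A S f ^ N i) ^ p)
    fun i ↦ (hf.pow _).pow _
  have hb' : ∀ i, b' i = KaehlerDifferential.D k S (algebraMap A S (y i)) := by
    intro i
    rw [Module.Basis.isUnitSMul_apply, hb, hy, Derivation.leibniz, hDp, smul_zero, add_zero]
  -- the dual derivations, up to powers of `f`
  let δ : Fin n → Derivation k A S := fun i ↦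
    ((b'.coord i).compDer (KaehlerDifferential.D k S)).compAlgebraMap A
  have hδ : ∀ i j, δ i (y j) = if i = j then 1 else 0 := by
    intro i j
    change b'.coord i (KaehlerDifferential.D k S (algebraMap A S (y j))) = _
    rw [← hb', Module.Basis.coord_apply, Module.Basis.repr_self, Finsupp.single_apply]
    simp [eq_comm]
  have : IsNoetherianRing A := Algebra.FiniteType.isNoetherianRing k A
  have : Module.FinitePresentation A (Ω[A⁄k]) := Module.finitePresentation_of_finite A _
  have hE : ∀ i, ∃ (M : ℕ) (E : Derivation k A A), ∀ a,
      algebraMap A S (E a) = algebraMap A S f ^ M * δ i a := by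
    intro i
    have : IsLocalizedModule (Submonoid.powers f) (Algebra.linearMap A S) := inferInstance
    obtain ⟨h, ⟨_, M, rfl⟩, hh⟩ := Module.FinitePresentation.exists_lift_of_isLocalizedModule
      (Submonoid.powers f) (Algebra.linearMap A S) (δ i).liftKaehlerDifferential
    refine ⟨M, h.compDer (KaehlerDifferential.D k A), fun a ↦ ?_⟩
    have := LinearMap.congr_fun hh (KaehlerDifferential.D k A a)
    rw [LinearMap.smul_apply, Derivation.liftKaehlerDifferential_comp_D] at this
    rw [← map_pow, ← Algebra.smul_def]
    exact this
  choose M E hE using hE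
  have hK : ∀ᶠ K : ℕ in Filter.atTop, ∀ i j,
      f ^ K * E i (y j) = f ^ K * (if i = j then f ^ M i else 0) := by
    refine Filter.eventually_all.2 fun i ↦ Filter.eventually_all.2 fun j ↦ ?_
    refine eventually_pow_mul_eq (S := S) ?_
    rw [hE, hδ]
    split_ifs <;> simp
  obtain ⟨K, hK⟩ := hK.exists
  -- the monomials span
  have hspan : ∀ a : A, ∀ᶠ N : ℕ in Filter.atTop, pthPower k p f ^ N • a ∈
      Submodule.span (pthPowers k p A) (Set.range (monomials p y)) := by
    intro a
    have htop := span_monomials_eq_top (p := p) (fun i ↦ algebraMap A S (y i)) (by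
      rw [← b'.span_eq]
      congr 2
      exact funext fun i ↦ (hb' i).symm)
    have ha : algebraMap A S a ∈ Submodule.span (pthPowers k p S)
      (Set.range (monomials p fun i ↦ algebraMap A S (y i))) := htop ▸ trivial
    have key : ∀ z ∈ Submodule.span (pthPowers k p S)
        (Set.range (monomials p fun i ↦ algebraMap A S (y i))), ∃ (N : ℕ), ∃ w ∈
          Submodule.span (pthPowers k p A) (Set.range (monomials p y)),
          (algebraMap A S f ^ p) ^ N * z = algebraMap A S w := by
      intro z hz
      induction hz using Submodule.span_induction with
      | mem z hz =>
        obtain ⟨γ, rfl⟩ := hz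
        exact ⟨0, _, Submodule.subset_span ⟨γ, rfl⟩, by simp [monomials]⟩
      | zero => exact ⟨0, 0, zero_mem _, by simp⟩
      | add z z' _ _ hz hz' =>
        obtain ⟨N, w, hw, h⟩ := hz
        obtain ⟨N', w', hw', h'⟩ := hz'
        refine ⟨N + N', pthPower k p f ^ N' • w + pthPower k p f ^ N • w',
          add_mem (Submodule.smul_mem _ _ hw) (Submodule.smul_mem _ _ hw'), ?_⟩
        have hsm : ∀ (N : ℕ) (w : A), algebraMap A S (pthPower k p f ^ N • w) =
            (algebraMap A S f ^ p) ^ N * algebraMap A S w := by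
          intro N w
          rw [← map_pow, ← map_pow, ← map_mul]
          rfl
        rw [map_add, hsm, hsm, ← h, ← h', pow_add]
        ring
      | smul c z _ hz =>
        obtain ⟨N, w, hw, h⟩ := hz
        obtain ⟨_, e, rfl⟩ := c
        obtain ⟨m, e', he⟩ := IsLocalization.Away.surj f e
        refine ⟨m + N, pthPower k p e' • w, Submodule.smul_mem _ _ hw, ?_⟩
        change _ * (e ^ p * z) = algebraMap A S (e' ^ p * w)
        rw [map_mul, map_pow, ← he, ← h]
        ring
    obtain ⟨N, w, hw, h⟩ := key _ ha
    rw [← map_pow, ← map_pow, ← map_mul] at h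
    obtain ⟨M₀, hM₀⟩ := Filter.eventually_atTop.1 (eventually_pow_mul_eq (f := f) h)
    filter_upwards [Filter.eventually_ge_atTop (N + M₀)] with N' hN'
    obtain ⟨c, rfl⟩ := Nat.exists_eq_add_of_le hN'
    have h1 : pthPower k p f ^ (N + M₀ + c) • a = pthPower k p f ^ (M₀ + c) • w := by
      change (f ^ p) ^ (N + M₀ + c) * a = (f ^ p) ^ (M₀ + c) * w
      rw [add_assoc, pow_add, ← pow_mul f p (M₀ + c),
        ← hM₀ (p * (M₀ + c)) (by nlinarith [hp.out.pos, Nat.le_add_right M₀ c])]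
      ring
    rw [h1]
    exact Submodule.smul_mem _ _ hw
  have hspan' : ∀ᶠ N : ℕ in Filter.atTop, ∀ a : A, pthPower k p f ^ N • a ∈
      Submodule.span (pthPowers k p A) (Set.range (monomials p y)) := by
    obtain ⟨t, ht⟩ := (finite_pthPowers k p A).fg_top
    filter_upwards [(Filter.eventually_all_finset t).2 fun a _ ↦ hspan a] with N hN
    have h1 : Submodule.span (pthPowers k p A) (t : Set A) ≤
        (Submodule.span (pthPowers k p A) (Set.range (monomials p y))).comap
          (LinearMap.lsmul (pthPowers k p A) A (pthPower k p f ^ N)) :=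
      Submodule.span_le.2 fun a ha ↦ hN a ha
    exact fun a ↦ h1 (ht ▸ trivial)
  obtain ⟨N₀, hN₀⟩ := Filter.eventually_atTop.1 hspan'
  -- With `g = f ^ (p * L)`, the derivation `E i` is multiplied by `f ^ (p * L - M i)`; this
  -- exponent is at least `K`, so the duality relations hold in `A` itself. The bound `1 ≤ L` serves
  -- the spanning condition.
  obtain ⟨L, hL1, hL⟩ : ∃ L : ℕ, 1 ≤ L ∧ ∀ i, K + M i ≤ p * L := by
    refine ⟨K + ∑ i, M i + 1, by omega, fun i ↦ ?_⟩
    have h1 := Finset.single_le_sum (f := M) (fun _ _ ↦ Nat.zero_le _) (Finset.mem_univ i)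
    nlinarith [hp.out.pos]
  refine ⟨L, y, fun i ↦ (f ^ (p * L - M i) • E i).overPthPowers, ?_, N₀, fun a ↦ ?_⟩
  · intro i j
    change f ^ (p * L - M i) * E i (y j) = _
    obtain ⟨c, hc⟩ := Nat.exists_eq_add_of_le (hL i)
    rw [show p * L - M i = c + K by omega, pow_add, mul_assoc, hK]
    split_ifs
    · change _ = (f ^ p) ^ L
      rw [← pow_mul, hc]
      ring
    · simp
  · rw [← pow_mul]
    exact hN₀ _ (Nat.le_mul_of_pos_left _ hL1) a

end PthPowers

section SmoothAlgebra

variable {k : Type u} [Field k] {p : ℕ} [hp : Fact p.Prime] [CharP k p] [PerfectRing k p]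
variable {A : Type u} [CommRing A] [Algebra k A]

/-- A maximal ideal containing all these `g` would contain `f ^ p` for every `f` of the standard
smooth cover. Its preimage under Frobenius `A → A^p` would then be the unit ideal. -/
theorem span_coordinates_eq_top [Algebra.FiniteType k A] {n : ℕ}
    (hA : RingHom.Locally (RingHom.IsStandardSmoothOfRelativeDimension n) (algebraMap k A)) :
    Ideal.span {g : pthPowers k p A | ∃ (x : Fin n → A)
      (D : Fin n → Derivation (pthPowers k p A) A A), IsCoordinateSystem p g x D} = ⊤ := by
  obtain ⟨s, hs, h⟩ := hA
  by_contra H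
  obtain ⟨q, hq, hle⟩ := Ideal.exists_le_maximal _ H
  have hqp := hq.isPrime
  have hmem : ∀ f ∈ s, pthPower k p f ∈ q := by
    intro f hf
    have hsm := h f hf
    rw [← IsScalarTower.algebraMap_eq,
      RingHom.isStandardSmoothOfRelativeDimension_algebraMap] at hsm
    have := hsm.isStandardSmooth
    obtain ⟨x, b, hb⟩ := exists_basis_kaehlerDifferential (k := k)
      (A := Localization.Away f) n
    obtain ⟨L, y, D, hc⟩ := exists_coordinates_of_away (p := p) f x b hb
    exact hqp.mem_of_pow_mem _ (hle (Ideal.subset_span ⟨y, D, hc⟩))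
  let F : A →+* pthPowers k p A :=
    { toFun := pthPower k p
      map_one' := Subtype.ext (one_pow p)
      map_mul' := fun a b ↦ Subtype.ext (mul_pow a b p)
      map_zero' := Subtype.ext (zero_pow hp.out.ne_zero)
      map_add' := fun a b ↦ Subtype.ext (by
        obtain ⟨r, hr⟩ := exists_add_pow_prime_eq hp.out a b
        change (a + b) ^ p = a ^ p + b ^ p
        rw [hr, natCast_prime_eq_zero k p A]
        simp) }
  have hle' : Ideal.span s ≤ q.comap F := Ideal.span_le.2 hmem
  rw [hs] at hle'
  exact (hqp.comap F).ne_top (top_le_iff.1 hle')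

end SmoothAlgebra

/-! ### Differential operators generated by Hamiltonian vector fields -/

section Hamiltonian

variable {k : Type*} [Field k] {p : ℕ} [hp : Fact p.Prime] [CharP k p] [PerfectRing k p]
variable {A : Type*} [CommRing A] [Algebra k A] {ω : BilinearFormOnVectorFields k A}

theorem form_hamiltonianVectorField (hω : IsSymplecticForm ω) (f : A) (E : Derivation k A A) :
    ω (hamiltonianVectorField hω f) E = E f :=
  LinearMap.congr_fun
    ((LinearEquiv.ofBijective ω hω.nondegenerate).apply_symm_apply (differentialForm f)) E

/-- The scalars that carry `E` into `S` form an ideal, so the question is local on the spectrum of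
the `p`-th powers. In coordinates it remains to express each `Dᵢ` through Hamiltonian vector fields.
-/
theorem subalgebra_eq_top_of_hamiltonian {n : ℕ} (hω : IsSymplecticForm ω)
    (hA : Ideal.span {g : pthPowers k p A | ∃ (x : Fin n → A)
      (D : Fin n → Derivation (pthPowers k p A) A A), IsCoordinateSystem p g x D} = ⊤)
    (S : Subalgebra (pthPowers k p A) (Module.End (pthPowers k p A) A))
    (hmul : ∀ a, LinearMap.mulLeft (pthPowers k p A) a ∈ S)
    (hham : ∀ f, ((hamiltonianVectorField hω f).overPthPowers (p := p) :
      A →ₗ[pthPowers k p A] A) ∈ S) : S = ⊤ := by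
  rw [eq_top_iff]
  rintro E -
  let I : Ideal (pthPowers k p A) := S.toSubmodule.comap (LinearMap.toSpanSingleton _ _ E)
  suffices hI : I = ⊤ by
    have h1 : (1 : pthPowers k p A) ∈ I := hI ▸ trivial
    simpa [I] using h1
  by_contra hI
  obtain ⟨q, hq, hle⟩ := Ideal.exists_le_maximal _ hI
  have hqp := hq.isPrime
  refine hqp.ne_top (top_le_iff.1 (hA ▸ Ideal.span_le.2 ?_))
  rintro g ⟨x, D, h⟩
  suffices hD : ∀ i, ∃ N : ℕ, g ^ N • (D i : A →ₗ[pthPowers k p A] A) ∈ S by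
    obtain ⟨M, hM⟩ := h.exists_pow_smul_mem (natCast_prime_eq_zero k p A) S hmul hD E
    exact hqp.mem_of_pow_mem M (hle hM)
  intro i
  obtain ⟨N, hN⟩ := h.exists_smul_derivation_eq
  let Dk : Fin n → Derivation k A A := fun i ↦ (D i).restrictScalars k
  have hNk : ∀ F : Derivation k A A,
      (g ^ (N + 1) : A) • F = (g ^ N : A) • ∑ j, F (x j) • Dk j := by
    intro F
    ext a
    have h1 := Derivation.congr_fun (hN F.overPthPowers) a
    simp only [Derivation.smul_apply, Derivation.sum_apply, Subalgebra.smul_def] at h1 ⊢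
    exact h1
  -- As `ω` is injective, it suffices to pair both sides with a derivation `F`: expand `F` in the
  -- `Dk j` and use `ω(H_{xⱼ}, F) = F(xⱼ)`.
  have key : (g ^ (N + 1) : A) • Dk i =
      (g ^ N : A) • ∑ j, ω (Dk i) (Dk j) • hamiltonianVectorField hω (x j) := by
    apply hω.nondegenerate.1
    ext F
    have h1 := congrArg (ω (Dk i)) (hNk F)
    simp only [map_smul, map_sum, LinearMap.smul_apply, LinearMap.sum_apply,
      form_hamiltonianVectorField] at h1 ⊢
    rw [h1]
    congr 1
    exact Finset.sum_congr rfl fun j _ ↦ by rw [smul_eq_mul, smul_eq_mul, mul_comm]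
  refine ⟨N + 1, ?_⟩
  have key' : g ^ (N + 1) • (D i : A →ₗ[pthPowers k p A] A) =
      g ^ N • ∑ j, LinearMap.mulLeft (pthPowers k p A) (ω (Dk i) (Dk j)) *
        ((hamiltonianVectorField hω (x j)).overPthPowers (p := p) :
          A →ₗ[pthPowers k p A] A) := by
    ext a
    have h1 := Derivation.congr_fun key a
    simp only [Derivation.smul_apply, Derivation.sum_apply, LinearMap.smul_apply,
      LinearMap.sum_apply, Module.End.mul_apply, LinearMap.mulLeft_apply, Subalgebra.smul_def]
      at h1 ⊢
    exact h1
  rw [key']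
  exact S.smul_mem (sum_mem fun j _ ↦ mul_mem (hmul _) (hham _)) _

end Hamiltonian

/-! ### Quantizations as algebras over a power series ring -/

section FormalQuantization

variable {R A B : Type*} [CommRing R] [CommRing A] [Algebra R A] [Ring B]
  [Algebra (PowerSeries R) B]

/-- `B` is a quantization of `A`, over the formal power series with coefficients in `R`, with
Hamiltonian vector fields `H`. -/
structure IsFormalQuantization (H : A → Derivation R A A) (π : B →+* A) : Prop where
  separated : ∀ b : B, (∀ n : ℕ, ∃ c, b = (PowerSeries.X : PowerSeries R) ^ n • c) → b = 0
  torsionFree : ∀ b : B, (PowerSeries.X : PowerSeries R) • b = 0 → b = 0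
  map_algebraMap : ∀ f : PowerSeries R,
    π (algebraMap _ B f) = algebraMap R A (PowerSeries.constantCoeff f)
  surjective : Function.Surjective π
  ker : ∀ b, π b = 0 → ∃ c, b = (PowerSeries.X : PowerSeries R) • c
  commutator : ∀ a b, ∃ c, a * b - b * a = (PowerSeries.X : PowerSeries R) • c ∧
    π c = H (π a) (π b)

namespace IsFormalQuantization

variable {H : A → Derivation R A A} {π : B →+* A} (h : IsFormalQuantization H π)

include h

theorem map_smul (f : PowerSeries R) (b : B) :
    π (f • b) = PowerSeries.constantCoeff f • π b := by
  rw [Algebra.smul_def, map_mul, h.map_algebraMap, Algebra.smul_def]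

theorem map_X_smul (b : B) : π ((PowerSeries.X : PowerSeries R) • b) = 0 := by
  rw [h.map_smul, PowerSeries.constantCoeff_X, zero_smul]

theorem smul_X_injective {a b : B}
    (hab : (PowerSeries.X : PowerSeries R) • a = (PowerSeries.X : PowerSeries R) • b) : a = b := by
  rw [← sub_eq_zero]
  exact h.torsionFree _ (by rw [smul_sub, hab, sub_self])

theorem nonempty_equiv [Module.Finite R A] [Module.Projective R A] :
    Nonempty ((PowerSeries R ⊗[R] A) ≃ₗ[PowerSeries R] B) := by
  let : Module R B := Module.compHom B (algebraMap R (PowerSeries R))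
  have : IsScalarTower R (PowerSeries R) B := IsScalarTower.of_algebraMap_smul fun _ _ ↦ rfl
  let πL : B →ₗ[R] A :=
    { π with
      map_smul' := fun r b ↦ by
        change π (PowerSeries.C r • b) = _
        rw [h.map_smul, PowerSeries.constantCoeff_C]
        rfl }
  exact exists_powerSeries_tensor_equiv h.separated h.torsionFree πL h.surjective h.map_X_smul
    h.ker

theorem finite [Module.Finite R A] [Module.Projective R A] : Module.Finite (PowerSeries R) B :=
  Module.Finite.equiv h.nonempty_equiv.some

theorem projective [Module.Finite R A] [Module.Projective R A] :
    Module.Projective (PowerSeries R) B :=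
  Module.Projective.of_equiv h.nonempty_equiv.some

theorem rankAtStalk_eq [Module.Finite R A] [Module.Projective R A] {r : ℕ}
    (hr : ∀ q : PrimeSpectrum R, Module.rankAtStalk A q = r) (q : PrimeSpectrum (PowerSeries R)) :
    Module.rankAtStalk B q = r := by
  rw [← Module.rankAtStalk_eq_of_equiv h.nonempty_equiv.some, Module.rankAtStalk_baseChange, hr]

theorem injective (hR : Function.Injective (algebraMap R A)) :
    Function.Injective (algebraMap (PowerSeries R) B) := by
  rw [injective_iff_map_eq_zero]
  intro f hf
  ext n
  induction n generalizing f with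
  | zero =>
    apply hR
    rw [PowerSeries.coeff_zero_eq_constantCoeff_apply, ← h.map_algebraMap, hf]
    simp
  | succ n ih =>
    have h0 : PowerSeries.constantCoeff f = 0 := by
      apply hR
      rw [← h.map_algebraMap, hf]
      simp
    have h1 := PowerSeries.eq_X_mul_shift_add_const f
    rw [h0, map_zero, add_zero] at h1
    have h2 := ih (PowerSeries.mk fun i ↦ PowerSeries.coeff (i + 1) f) (by
      apply h.torsionFree
      rw [Algebra.smul_def, ← map_mul, ← h1, hf])
    simpa using h2

/-- Pointwise quotients by `X` are unique by torsion-freeness, hence assemble to a linear map. -/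
theorem exists_smul_eq (θ : Module.End (PowerSeries R) B) (hθ : ∀ b, π (θ b) = 0) :
    ∃ θ' : Module.End (PowerSeries R) B, θ = (PowerSeries.X : PowerSeries R) • θ' := by
  choose c hc using fun b ↦ h.ker _ (hθ b)
  refine ⟨{ toFun := c, map_add' := fun a b ↦ ?_, map_smul' := fun f b ↦ ?_ }, ?_⟩
  · apply h.smul_X_injective
    rw [← hc, map_add, hc, hc, smul_add]
  · apply h.smul_X_injective
    rw [← hc, _root_.map_smul, hc, RingHom.id_apply, smul_comm]
  · ext b
    exact hc b

theorem exists_reduction (φ : Module.End (PowerSeries R) B) :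
    ∃ ψ : Module.End R A, ∀ b, π (φ b) = ψ (π b) := by
  have hφ : ∀ b b', π b = π b' → π (φ b) = π (φ b') := by
    intro b b' hb
    obtain ⟨c, hc⟩ := h.ker (b - b') (by rw [map_sub, hb, sub_self])
    rw [← sub_eq_zero, ← map_sub, ← map_sub, hc, _root_.map_smul, h.map_X_smul]
  choose σ hσ using h.surjective
  refine ⟨{ toFun := fun a ↦ π (φ (σ a)), map_add' := fun a b ↦ ?_, map_smul' := fun r a ↦ ?_ },
    fun b ↦ hφ _ _ (hσ _).symm⟩
  · rw [← map_add, ← map_add]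
    exact hφ _ _ (by rw [map_add, hσ, hσ, hσ])
  · rw [RingHom.id_apply, ← PowerSeries.constantCoeff_C (R := R) r, ← h.map_smul,
      ← _root_.map_smul]
    exact hφ _ _ (by rw [h.map_smul, hσ, hσ])

/-- The saturation `T` of the image contains the operators `X⁻¹[a, -]`. The reductions of `T`
exhaust `End_R(A)` by `hgen`, so `T` is everything by Nakayama's lemma. -/
theorem pow_smul_mem_range_mulLeftRight [Module.Finite R A] [Module.Projective R A]
    (hgen : ∀ S : Subalgebra R (Module.End R A), (∀ a, LinearMap.mulLeft R a ∈ S) →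
      (∀ a, (H a : A →ₗ[R] A) ∈ S) → S = ⊤)
    (φ : Module.End (PowerSeries R) B) :
    ∃ N : ℕ, (PowerSeries.X : PowerSeries R) ^ N • φ ∈
      (AlgHom.mulLeftRight (PowerSeries R) B).range := by
  let T := (AlgHom.mulLeftRight (PowerSeries R) B).range.powSaturation PowerSeries.X
  let S : Subalgebra R (Module.End R A) :=
    { carrier := {ψ | ∃ φ ∈ T, ∀ b, π (φ b) = ψ (π b)}
      mul_mem' := by
        rintro ψ ψ' ⟨φ, hφ, h1⟩ ⟨φ', hφ', h2⟩
        exact ⟨φ * φ', mul_mem hφ hφ', fun b ↦ by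
          rw [Module.End.mul_apply, Module.End.mul_apply, h1, h2]⟩
      add_mem' := by
        rintro ψ ψ' ⟨φ, hφ, h1⟩ ⟨φ', hφ', h2⟩
        exact ⟨φ + φ', add_mem hφ hφ', fun b ↦ by
          rw [LinearMap.add_apply, LinearMap.add_apply, map_add, h1, h2]⟩
      algebraMap_mem' := fun r ↦ ⟨algebraMap _ _ (PowerSeries.C r), T.algebraMap_mem _, fun b ↦ by
        rw [Module.algebraMap_end_apply, Module.algebraMap_end_apply, h.map_smul,
          PowerSeries.constantCoeff_C]⟩ }
  have hS : S = ⊤ := by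
    refine hgen S (fun a ↦ ?_) (fun a ↦ ?_)
    · obtain ⟨a, rfl⟩ := h.surjective a
      refine ⟨LinearMap.mulLeft _ a, Subalgebra.le_powSaturation _ _ ⟨a ⊗ₜ 1, ?_⟩, fun b ↦ ?_⟩
      · ext b
        simp
      · simp
    · obtain ⟨a, rfl⟩ := h.surjective a
      -- Since `A` is commutative, the commutator with `a` vanishes modulo `X`; its quotient by `X`
      -- reduces to the derivation `H (π a)`.
      have hz : ∀ b, π ((LinearMap.mulLeft (PowerSeries R) a -
          LinearMap.mulRight (PowerSeries R) a) b) = 0 := by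
        intro b
        simp [mul_comm]
      obtain ⟨θ, hθ⟩ := h.exists_smul_eq _ hz
      refine ⟨θ, ⟨1, a ⊗ₜ 1 - 1 ⊗ₜ MulOpposite.op a, ?_⟩, fun b ↦ ?_⟩
      · rw [pow_one, ← hθ]
        ext b
        change AlgHom.mulLeftRight _ _ _ b = _
        simp
      · obtain ⟨c, hc, hc'⟩ := h.commutator a b
        have h1 := LinearMap.congr_fun hθ b
        simp only [LinearMap.sub_apply, LinearMap.mulLeft_apply, LinearMap.mulRight_apply, hc,
          LinearMap.smul_apply] at h1
        rw [← h.smul_X_injective h1, hc']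
        rfl
  have := h.finite
  have := h.projective
  have := (projective_and_finite_end (PowerSeries R) B).2
  have hT : T.toSubmodule = ⊤ := by
    refine submodule_eq_top_of_powerSeries _ fun φ ↦ ?_
    obtain ⟨ψ, hψ⟩ := h.exists_reduction φ
    obtain ⟨φ', hφ', h'⟩ : ψ ∈ S := hS ▸ trivial
    obtain ⟨θ, hθ⟩ := h.exists_smul_eq (φ - φ') fun b ↦ by
      rw [LinearMap.sub_apply, map_sub, hψ, h', sub_self]
    exact ⟨φ', hφ', θ, by rw [← hθ]; abel⟩
  have hφ : φ ∈ T.toSubmodule := hT ▸ trivial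
  exact hφ

end IsFormalQuantization

end FormalQuantization

/-! ### Base change of quantizations -/

section BaseChange

variable {R A B R' A' B' : Type*} [CommRing R] [CommRing A] [Algebra R A] [Ring B]
  [Algebra (PowerSeries R) B] [CommRing R'] [CommRing A'] [Algebra R' A'] [Ring B']
  [Algebra (PowerSeries R') B'] {H : A → Derivation R A A} {π : B →+* A}
  {H' : A' → Derivation R' A' A'} {π' : B' →+* A'}

theorem IsFormalQuantization.bijective_liftBaseChange (h : IsFormalQuantization H π)
    (h' : IsFormalQuantization H' π') [Module.Finite R A] [Module.Projective R A]
    [Module.Finite R' A'] [Module.Projective R' A'] {r : ℕ}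
    (hr : ∀ q : PrimeSpectrum R, Module.rankAtStalk A q = r)
    (hr' : ∀ q : PrimeSpectrum R', Module.rankAtStalk A' q = r)
    [Algebra (PowerSeries R) (PowerSeries R')] [Module (PowerSeries R) B']
    [IsScalarTower (PowerSeries R) (PowerSeries R') B']
    (ρ : B →ₗ[PowerSeries R] B') (hρ : Submodule.span R' (Set.range fun b ↦ π' (ρ b)) = ⊤) :
    Function.Bijective (ρ.liftBaseChange (PowerSeries R')) := by
  have := h.finite
  have := h.projective
  have := h'.finite
  have := h'.projective
  refine bijective_of_surjective_of_rankAtStalk_eq _ ?_ ?_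
  · rw [← LinearMap.range_eq_top]
    refine submodule_eq_top_of_powerSeries _ fun b' ↦ ?_
    have key : ∀ a ∈ Submodule.span R' (Set.range fun b ↦ π' (ρ b)),
        ∃ t ∈ (ρ.liftBaseChange (PowerSeries R')).range, π' t = a := by
      intro a ha
      induction ha using Submodule.span_induction with
      | mem a ha =>
        obtain ⟨b, rfl⟩ := ha
        exact ⟨ρ b, ⟨1 ⊗ₜ b, by simp⟩, rfl⟩
      | zero => exact ⟨0, zero_mem _, map_zero _⟩
      | add a a' _ _ ha ha' =>
        obtain ⟨t, ht, rfl⟩ := ha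
        obtain ⟨t', ht', rfl⟩ := ha'
        exact ⟨t + t', add_mem ht ht', map_add _ _ _⟩
      | smul c a _ ha =>
        obtain ⟨t, ht, rfl⟩ := ha
        exact ⟨PowerSeries.C c • t, Submodule.smul_mem _ _ ht, by
          rw [h'.map_smul, PowerSeries.constantCoeff_C]⟩
    obtain ⟨t, ht, hb⟩ := key (π' b') (hρ ▸ trivial)
    obtain ⟨c, hc⟩ := h'.ker (b' - t) (by rw [map_sub, hb, sub_self])
    exact ⟨t, ht, c, by rw [← hc]; abel⟩
  · ext q
    rw [Module.rankAtStalk_baseChange, h.rankAtStalk_eq hr, h'.rankAtStalk_eq hr']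

end BaseChange

/-- This is `G ⊗[P] M ≃ G ⊗[P'] (P' ⊗[P] M)`. The hypothesis `hb` ranges over instances because the
`P`-structures on `P'` and `M'` are built from `φ` only inside the proof. -/
theorem exists_baseChange_equiv {P P' G M M' : Type*} [CommRing P] [CommRing P'] [CommRing G]
    [Algebra P' G] [AddCommGroup M] [Module P M] [AddCommGroup M'] [Module P' M'] (φ : P →+* P')
    (ρ : M →+ M') (hρ : ∀ f m, ρ (f • m) = φ f • ρ m)
    (hb : ∀ [Algebra P P'] [Module P M'] [IsScalarTower P P' M'] (ρ' : M →ₗ[P] M'),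
      ⇑ρ' = ρ → Function.Bijective (ρ'.liftBaseChange P')) :
    letI := ((algebraMap P' G).comp φ).toAlgebra
    ∃ e : (G ⊗[P] M) ≃ₗ[G] (G ⊗[P'] M'), ∀ g m, e (g ⊗ₜ m) = g ⊗ₜ ρ m := by
  let : Algebra P G := ((algebraMap P' G).comp φ).toAlgebra
  let : Algebra P P' := φ.toAlgebra
  have : IsScalarTower P P' G := IsScalarTower.of_algebraMap_eq fun _ ↦ rfl
  let : Module P M' := Module.compHom _ φ
  have : IsScalarTower P P' M' := IsScalarTower.of_algebraMap_smul fun _ _ ↦ rfl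
  let ρ' : M →ₗ[P] M' := { ρ with map_smul' := hρ }
  refine ⟨(AlgebraTensorModule.cancelBaseChange P P' G G M).symm ≪≫ₗ
    AlgebraTensorModule.congr (.refl _ _) (LinearEquiv.ofBijective _ (hb ρ' rfl)), fun g m ↦ ?_⟩
  simp [ρ']

/-! ### Quantizations with a Frobenius-constant structure -/

section PowerSeriesExtension

variable {k : Type*} [Field k] {B : Type*} [Ring B] [Algebra (PowerSeries k) B]
variable {R : Type*} [CommRing R] (s : R →+* Subring.center B)

theorem powerSeriesExtension_X
    (hB : IsAdicComplete (Ideal.span {(PowerSeries.X : PowerSeries k)}) B) :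
    powerSeriesExtension (k := k) hB s PowerSeries.X = hbar k B := by
  refine extension_unique (k := k) s hB _ (exists_extension s hB _).choose_spec fun n ↦ ?_
  nth_rw 1 [← polynomialExtension_X (k := k) s]
  refine polynomialExtension_of_coeff (k := k) s fun i hi ↦ ?_
  rw [PowerSeries.coeff_trunc, if_pos hi, PowerSeries.coeff_X, Polynomial.coeff_X]
  simp [eq_comm]

theorem powerSeriesExtension_C
    (hB : IsAdicComplete (Ideal.span {(PowerSeries.X : PowerSeries k)}) B) (r : R) :
    powerSeriesExtension hB s (PowerSeries.C r) = s r := by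
  refine extension_unique (k := k) s hB _ (exists_extension s hB _).choose_spec fun n ↦ ?_
  rw [show (s r : B) = polynomialExtension k s (Polynomial.C r) by simp [polynomialExtension]]
  refine polynomialExtension_of_coeff (k := k) s fun i hi ↦ ?_
  rw [PowerSeries.coeff_trunc, if_pos hi, PowerSeries.coeff_C, Polynomial.coeff_C]

end PowerSeriesExtension

theorem IsQuantization.isFormalQuantization {k : Type*} [Field k] {p : ℕ} [Fact p.Prime]
    [CharP k p] [PerfectRing k p] {A : Type*} [CommRing A] [Algebra k A]
    {ω : BilinearFormOnVectorFields k A} (hω : IsSymplecticForm ω) {B : Type*} [Ring B]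
    [Algebra (PowerSeries k) B] {π : B →+* A} (hQ : IsQuantization (poissonBracket hω) B π)
    (s : pthPowers k p A →+* Subring.center B) (hs : ∀ a, π (s a) = a) :
    letI := powerSeriesAlgebra (k := k) hQ.complete s
    IsFormalQuantization
      (fun a ↦ (hamiltonianVectorField hω a).overPthPowers (p := p)) π := by
  let := powerSeriesAlgebra (k := k) hQ.complete s
  have hsmul : ∀ b : B, (PowerSeries.X : PowerSeries (pthPowers k p A)) • b = hbar k B * b := by
    intro b
    rw [Algebra.smul_def]
    congr 1
    exact powerSeriesExtension_X (k := k) s hQ.complete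
  have hpow : ∀ (n : ℕ) (b : B),
      (PowerSeries.X : PowerSeries (pthPowers k p A)) ^ n • b = hbar k B ^ n * b := by
    intro n b
    induction n with
    | zero => simp
    | succ n ih => rw [pow_succ', mul_smul, ih, hsmul, pow_succ', mul_assoc]
  have hπ : ∀ b, π (hbar k B * b) = 0 := by
    intro b
    rw [map_mul, hbar, hQ.map_algebraMap, PowerSeries.constantCoeff_X, map_zero, zero_mul]
  refine ⟨fun b hb ↦ ?_, fun b hb ↦ ?_, fun f ↦ ?_, hQ.surjective, fun b hb ↦ ?_, fun a b ↦ ?_⟩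
  · refine eq_of_hbar hQ.complete fun n ↦ ?_
    obtain ⟨c, hc⟩ := hb n
    exact ⟨c, by rw [sub_zero, hc, hpow]⟩
  · have := hQ.flat
    have hreg := Module.Flat.isSMulRegular_of_nonZeroDivisors (M := B)
      (mem_nonZeroDivisors_of_ne_zero (PowerSeries.X_ne_zero (R := k)))
    apply hreg
    change (PowerSeries.X : PowerSeries k) • b = (PowerSeries.X : PowerSeries k) • (0 : B)
    rw [smul_zero, Algebra.smul_def]
    rwa [hsmul] at hb
  · have h1 : algebraMap (PowerSeries (pthPowers k p A)) B f =
        hbar k B * algebraMap _ B (PowerSeries.mk fun i ↦ PowerSeries.coeff (i + 1) f) +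
          s (PowerSeries.constantCoeff f) := by
      conv_lhs => rw [PowerSeries.eq_X_mul_shift_add_const f, map_add, map_mul]
      rw [← hsmul, Algebra.smul_def]
      congr 1
      exact powerSeriesExtension_C s hQ.complete _
    rw [h1, map_add, hπ, hs, zero_add]
    rfl
  · obtain ⟨c, hc⟩ := hQ.ker b hb
    exact ⟨c, by rw [hc, hsmul]⟩
  · obtain ⟨c, hc, hc'⟩ := hQ.commutator a b
    exact ⟨c, by rw [hc, hsmul], hc'⟩

/-! ### Functions on affine open subschemes -/

section AffineOpens

variable {k : Type u} [Field k] {X : Scheme.{u}} [X.Over (Spec (.of k))]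

theorem finiteType_sections [LocallyOfFiniteType (X ↘ Spec (.of k))] (U : X.affineOpens) :
    Algebra.FiniteType k Γ(X, U) := by
  have h1 := HasRingHomProperty.appLE @LocallyOfFiniteType (X ↘ Spec (.of k)) inferInstance
    ⟨⊤, isAffineOpen_top _⟩ U le_top
  have h2 := RingHom.finiteType_respectsIso.2 _
    (Scheme.ΓSpecIso (.of k)).symm.commRingCatIsoToRingEquiv h1
  exact h2

theorem locally_isStandardSmooth_sections (n : ℕ)
    [SmoothOfRelativeDimension n (X ↘ Spec (.of k))] (U : X.affineOpens) :
    RingHom.Locally (RingHom.IsStandardSmoothOfRelativeDimension n)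
      (algebraMap k Γ(X, U)) := by
  have h1 := HasRingHomProperty.appLE (@SmoothOfRelativeDimension n) (X ↘ Spec (.of k)) inferInstance
    ⟨⊤, isAffineOpen_top _⟩ U le_top
  have h2 := (HasRingHomProperty.isLocal_ringHomProperty
    (@SmoothOfRelativeDimension n)).respectsIso.2 _
      (Scheme.ΓSpecIso (.of k)).symm.commRingCatIsoToRingEquiv h1
  exact h2

/-- On spectra, restriction followed by the inclusion of `U` is the open immersion of `V`, a
monomorphism. -/
theorem epi_restrict {U V : X.affineOpens} (i : V.1 ≤ U.1) :
    Epi (X.presheaf.map (homOfLE i).op) := by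
  have h1 : Mono (Spec.map (X.presheaf.map (homOfLE i).op)) := by
    have h2 : Mono (Spec.map (X.presheaf.map (homOfLE i).op) ≫ U.2.fromSpec) := by
      rw [U.2.map_fromSpec V.2]
      have := V.2.isOpenImmersion_fromSpec
      infer_instance
    exact mono_of_mono _ U.2.fromSpec
  have h3 : Mono (X.presheaf.map (homOfLE i).op).op := Scheme.Spec.mono_of_mono_map h1
  exact unop_epi_of_mono (X.presheaf.map (homOfLE i).op).op

/-- The subalgebra generated by the `p`-th powers and the restricted functions includes into `Γ(X,
V)` by a finite map, which is an epimorphism because restriction factors through it. Hence it is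
everything, and the generators are already closed under multiplication. -/
theorem span_range_restrictFunctions (p : ℕ) [Fact p.Prime] [CharP k p] [PerfectRing k p]
    [LocallyOfFiniteType (X ↘ Spec (.of k))] {U V : X.affineOpens} (i : V.1 ≤ U.1) :
    Submodule.span (pthPowers k p Γ(X, V)) (Set.range (restrictFunctions i)) = ⊤ := by
  have := finiteType_sections (k := k) V
  have := finite_pthPowers k p Γ(X, V)
  let A' := Algebra.adjoin (pthPowers k p Γ(X, V)) (Set.range (restrictFunctions i))
  have : Module.Finite A' Γ(X, V) :=
    Module.Finite.of_restrictScalars_finite (pthPowers k p Γ(X, V)) A' _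
  let j : Γ(X, U) →+* A' := (restrictFunctions i).codRestrict A' fun a ↦
    Algebra.subset_adjoin ⟨a, rfl⟩
  have h1 := epi_restrict i
  have h2 : Epi (CommRingCat.ofHom j ≫ CommRingCat.ofHom (algebraMap A' Γ(X, V))) := h1
  have h3 : Epi (CommRingCat.ofHom (algebraMap A' Γ(X, V))) := epi_of_epi (CommRingCat.ofHom j) _
  have h4 := RingHom.surjective_of_epi_of_finite (CommRingCat.ofHom (algebraMap A' Γ(X, V)))
    (RingHom.finite_algebraMap.2 this)
  rw [eq_top_iff]
  rintro a -
  obtain ⟨⟨a, ha⟩, rfl⟩ := h4 a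
  change a ∈ _
  rw [← Subalgebra.mem_toSubmodule, Algebra.adjoin_eq_span] at ha
  have h5 : (Submonoid.closure (Set.range (restrictFunctions i)) : Set Γ(X, V)) =
      Set.range (restrictFunctions i) := by
    rw [← RingHom.coe_range, ← Subring.coe_toSubmonoid, Submonoid.closure_eq]
  rwa [h5] at ha

end AffineOpens

/-! ### Sections over affine opens and their restriction -/

namespace FrobeniusLift

variable {k : Type u} [Field k] {p : ℕ} [Fact p.Prime] [CharP k p] [PerfectRing k p]
  {X : Scheme.{u}} [X.Over (Spec (.of k))] {ω : SymplecticForm k X} {Q : SchemeQuantization ω}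
  (s : FrobeniusLift p Q)

/-- The reduction modulo `h` of the sections of the quantization over an affine open. -/
noncomputable def reduction (U : X.affineOpens) : s.sections U →+* Γ(X, U) := Q.reduction U

theorem isFormalQuantization (U : X.affineOpens) :
    IsFormalQuantization (B := s.sections U)
      (fun a ↦ (hamiltonianVectorField (ω.isSymplecticForm U) a).overPthPowers (p := p))
      (s.reduction U) :=
  (Q.isQuantization U).isFormalQuantization (ω.isSymplecticForm U) (s.lift U) (s.reduction_lift U)

/-- The quantization parameter, as a section of the quantization. -/
noncomputable def hbarSection (U : X.affineOpens) : s.sections U :=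
  hbar k (Q.sheaf.presheaf.obj (op U.1))

/-- The lift of a `p`-th power, as a section of the quantization. -/
noncomputable def liftSection (U : X.affineOpens) (r : pthPowers k p Γ(X, U)) : s.sections U :=
  (s.lift U r).1

theorem X_smul (U : X.affineOpens) (b : s.sections U) :
    (PowerSeries.X : formalFunctions k p U) • b = s.hbarSection U * b :=
  congrArg (fun c : s.sections U ↦ c * b)
    (powerSeriesExtension_X (k := k) (s.lift U) (Q.isQuantization U).complete)

theorem C_smul (U : X.affineOpens) (r : pthPowers k p Γ(X, U)) (b : s.sections U) :
    (PowerSeries.C r : formalFunctions k p U) • b = s.liftSection U r * b :=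
  congrArg (fun c : s.sections U ↦ c * b)
    (powerSeriesExtension_C (s.lift U) (Q.isQuantization U).complete r)

theorem restrictSections_hbarSection {U V : X.affineOpens} (i : V.1 ≤ U.1) :
    s.restrictSections i (s.hbarSection U) = s.hbarSection V :=
  (Q.sheaf.presheaf.map (homOfLE i).op).hom.commutes _

theorem restrictSections_liftSection {U V : X.affineOpens} (i : V.1 ≤ U.1)
    (r : pthPowers k p Γ(X, U)) :
    s.restrictSections i (s.liftSection U r) =
      s.liftSection V (pthPowersMap k p (restrictFunctions i) r) :=
  (s.lift_restrict i r).symm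

/-- Restriction respects `h` and the lifts of `p`-th powers, so splitting off constant terms shows
the difference to be divisible by every power of `X`. -/
theorem restrictSections_smul {U V : X.affineOpens} (i : V.1 ≤ U.1) (f : formalFunctions k p U)
    (b : s.sections U) :
    s.restrictSections i (f • b) = restrictFormalFunctions k p i f • s.restrictSections i b := by
  rw [← sub_eq_zero]
  refine (s.isFormalQuantization V).separated _ fun n ↦ ?_
  induction n generalizing f with
  | zero => exact ⟨_, (one_smul _ _).symm⟩
  | succ n ih =>
    set g : formalFunctions k p U := PowerSeries.mk fun i ↦ PowerSeries.coeff (i + 1) f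
    have hf : f = PowerSeries.X * g + PowerSeries.C (PowerSeries.constantCoeff f) :=
      PowerSeries.eq_X_mul_shift_add_const f
    obtain ⟨c, hc⟩ := ih g
    refine ⟨c, ?_⟩
    rw [pow_succ', mul_smul, ← hc, hf, add_smul, mul_smul, map_add, X_smul, C_smul, map_mul, map_mul,
      restrictSections_hbarSection, restrictSections_liftSection, map_add, map_mul, add_smul,
      mul_smul]
    simp only [restrictFormalFunctions, PowerSeries.map_X, PowerSeries.map_C]
    rw [← X_smul, ← C_smul, smul_sub]
    abel

theorem reduction_restrictSections {U V : X.affineOpens} (i : V.1 ≤ U.1) (b : s.sections U) :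
    s.reduction V (s.restrictSections i b) = restrictFunctions i (s.reduction U b) :=
  Q.reduction_restrict i b

theorem span_localDualBasis_eq_top (n : ℕ) [SmoothOfRelativeDimension n (X ↘ Spec (.of k))]
    (U : X.affineOpens) :
    Ideal.span {w : pthPowers k p Γ(X, U) | ∃ (b : (Fin n → Fin p) → Γ(X, U))
      (φ : (Fin n → Fin p) → Γ(X, U) →ₗ[pthPowers k p Γ(X, U)] pthPowers k p Γ(X, U)),
        IsLocalDualBasis w b φ} = ⊤ := by
  have := SmoothOfRelativeDimension.smooth n (X ↘ Spec (.of k))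
  have := finiteType_sections (k := k) U
  have h := span_coordinates_eq_top (p := p) (locally_isStandardSmooth_sections (k := k) n U)
  by_contra H
  obtain ⟨q, hq, hle⟩ := Ideal.exists_le_maximal _ H
  have hqp := hq.isPrime
  refine hqp.ne_top (top_le_iff.1 (h ▸ Ideal.span_le.2 ?_))
  rintro g ⟨x, D, hc⟩
  obtain ⟨N, φ, hφ⟩ := hc.exists_localDualBasis (natCast_prime_eq_zero k p _)
    Subtype.val_injective
  rcases hqp.mem_or_mem (hle (Ideal.subset_span ⟨_, φ, hφ⟩)) with h1 | h1
  · exact hqp.mem_of_pow_mem _ h1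
  · exact hqp.mem_of_pow_mem _ (neg_mem_iff.1 (hqp.mem_of_pow_mem _ h1))

end FrobeniusLift

theorem mainTheorem10 {k : Type u} [Field k] (p : ℕ) [Fact p.Prime] [CharP k p] [PerfectRing k p]
    {X : Scheme.{u}} [X.Over (Spec (.of k))] (n : ℕ)
    [SmoothOfRelativeDimension n (X ↘ Spec (.of k))]
    (ω : SymplecticForm k X) (Q : SchemeQuantization ω) (s : FrobeniusLift p Q) :
    s.IsAzumayaOnGenericFiber (p ^ n) := by
  have := SmoothOfRelativeDimension.smooth n (X ↘ Spec (.of k))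
  have hfin (U : X.affineOpens) : Algebra.FiniteType k Γ(X, U) := finiteType_sections U
  have hdual (U : X.affineOpens) :=
    FrobeniusLift.span_localDualBasis_eq_top (k := k) (p := p) n U
  have hP (U : X.affineOpens) : Module.Projective (pthPowers k p Γ(X, U)) Γ(X, U) :=
    (projective_and_finite_of_span_localDualBasis (hdual U)).1
  have hF (U : X.affineOpens) : Module.Finite (pthPowers k p Γ(X, U)) Γ(X, U) :=
    (projective_and_finite_of_span_localDualBasis (hdual U)).2
  have hr (U : X.affineOpens) (q : PrimeSpectrum (pthPowers k p Γ(X, U))) :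
      Module.rankAtStalk Γ(X, U) q = p ^ n := by
    rw [rankAtStalk_of_span_localDualBasis (hdual U) q]
    simp
  have hBF (U : X.affineOpens) := (s.isFormalQuantization U).finite
  have hBP (U : X.affineOpens) := (s.isFormalQuantization U).projective
  have hBL (U : X.affineOpens) : Module.Flat (formalFunctions k p U) (s.sections U) :=
    have := hBP U
    Module.Flat.of_projective
  refine ⟨fun U ↦ ?_, fun U x ↦ ?_, fun {U V} i ↦ ?_⟩
  · refine isAzumaya_of_localization (PowerSeries.X : formalFunctions k p U)
      ((s.isFormalQuantization U).injective Subtype.val_injective) ?_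
    exact (s.isFormalQuantization U).pow_smul_mem_range_mulLeftRight fun S hmul hham ↦
      subalgebra_eq_top_of_hamiltonian (ω.isSymplecticForm U)
        (span_coordinates_eq_top (locally_isStandardSmooth_sections (k := k) n U)) S hmul hham
  · rw [Module.rankAtStalk_baseChange]
    exact (s.isFormalQuantization U).rankAtStalk_eq (hr U) _
  · refine exists_baseChange_equiv (restrictFormalFunctions k p i)
      (s.restrictSections i).toAddMonoidHom (s.restrictSections_smul i) fun ρ hρ ↦
        (s.isFormalQuantization U).bijective_liftBaseChange (s.isFormalQuantization V)
          (hr U) (hr V) ρ ?_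
    -- Reduction is surjective over `U`, so the reductions of restricted sections are exactly the
    -- restricted functions.
    rw [← span_range_restrictFunctions p i, hρ]
    congr 1
    ext a
    constructor
    · rintro ⟨b, rfl⟩
      exact ⟨s.reduction U b, (s.reduction_restrictSections i b).symm⟩
    · rintro ⟨a, rfl⟩
      obtain ⟨b, rfl⟩ := (s.isFormalQuantization U).surjective a
      exact ⟨b, s.reduction_restrictSections i b⟩
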